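/- Let $\rho\in(-1,1)\setminus\{0\}$, let $m\ge 0$ be a fixed integer, and let $\varepsilon_1,\dots,\varepsilon_m$ be fixed real numbers with $|\rho+\varepsilon_j|>|\rho|$ for all $j$. For each $n$ let $k_1<\dots<k_m$ be break points in $\{1,\dots,n\}$, depending on $n$, such that, with $k_0=0$, $$\min_{1\le j\le m}(k_j-k_{j-1})\to\infty\quad\text{and}\quad n-k_m\to\infty\qquad(n\to\infty)$$ (no condition if $m=0$). Let $y_0=0$ and $y_t=\rho_t y_{t-1}+z_t$ for $1\le t\le n$, where $\rho_t=\rho+\sum_{j=1}^m\varepsilon_j\mathbf 1_{\{t=k_j\}}$ (a structural change model in which every change has length $1$) and $(z_t)$ is a white noise (centred, pairwise uncorrelated, variance $1$). Let $B_n=[\mathrm{var}(y_1,\dots,y_n)]^{-1}\in\mathbb R^{n\times n}$ be the precision matrix. As $n\to\infty$ the empirical spectral distributions of $B_n$ converge weakly to the law $\mu_\rho$ of $1+\rho^2-2\rho\cos U$, $U$ uniform on $[0,2\pi]$, whose support is $[a_\rho,b_\rho]=[(1-|\rho|)^2,(1+|\rho|)^2]$. An outlier of $\{B_n\}$ is a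 point $x\notin[a_\rho,b_\rho]$ with $\lim_{n\to\infty}\inf_{\lambda\in\mathrm{spec}(B_n)}|x-\lambda|=0$; let $out_L(\{B_n\})$ and $out_R(\{B_n\})$ be the sets of outliers in $(-\infty,a_\rho)$ and in $(b_\rho,\infty)$. The multiplicity of an outlier $x$ is the number $r$ such that for every sufficiently small $\delta>0$ and all sufficiently large $n$ (depending on $\delta$), exactly $r$ eigenvalues of $B_n$, counted with multiplicity, lie in $(x-\delta,x+\delta)$. Then every outlier has a multiplicity, and, as multisets, $$out_L(\{B_n\})=\{m_1,\dots,m_m\},\qquad out_R(\{B_n\})=\{M_1,\dots,M_m\}.$$ Here, with $$s_j,\,t_j=\frac{\rho\varepsilon_j(\varepsilon_j+2\rho)\mp\sqrt{\rho^2\varepsilon_j^2(\varepsilon_j+2\rho)^2+4\rho^2(\varepsilon_j+\rho)^2}}{2(\varepsilon_j+\rho)^2}$$ ($-$ for $s_j$, $+$ for $t_j$) and $f(x)=1+\rho^2-\rho(x+x^{-1})$, one has $(m_j,M_j)=(f(t_j),f(s_j))$ if $0<\rho<1$ and $(m_j,M_j)=(f(s_j),f(t_j))$ if $-1<\rho<0$.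 -/

import Mathlib

open MeasureTheory ProbabilityTheory Filter Topology

namespace SCM

noncomputable section

/-! ### The model -/

/-- White noise with unit variance: square integrable, centred, variance one, and pairwise
uncorrelated random variables. -/
structure IsUnitWhiteNoise {Ω : Type*} [MeasurableSpace Ω] (P : Measure Ω)
    (z : ℕ → Ω → ℝ) : Prop where
  memLp : ∀ t, MemLp (z t) 2 P
  mean_zero : ∀ t, ∫ ω, z t ω ∂P = 0
  variance_one : ∀ t, variance (z t) P = 1
  uncorrelated : ∀ s t, s ≠ t → covariance (z s) (z t) P = 0

/-- The time-varying AR(1) process `y_t = ρ_t y_{t-1} + z_t` for `t ≥ 1`, with `y_0 = 0`. -/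
def arProcess {Ω : Type*} (r : ℕ → ℝ) (z : ℕ → Ω → ℝ) : ℕ → Ω → ℝ
  | 0 => fun _ => 0
  | t + 1 => fun ω => r (t + 1) * arProcess r z t ω + z (t + 1) ω

/-- The coefficients `ρ_t = ρ + ∑_j ε_j 1_{E_j}(t)` of the structural change model, where
`E_j = [k_j, k_j + h_j - 1]` (as a set of natural numbers, the half-open `[k_j, k_j + h_j)`). -/
def coeff {m : ℕ} (ρ : ℝ) (ε : Fin m → ℝ) (k h : Fin m → ℕ) (t : ℕ) : ℝ :=
  ρ + ∑ j, ε j * (Set.Ico (k j) (k j + h j)).indicator (fun _ => (1 : ℝ)) t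

/-- The spacing `Δ_j = k_j - (k_{j-1} + h_{j-1} - 1)` between consecutive changes, with the
convention `k_0 + h_0 - 1 = 0` for the first one. -/
def gap {m : ℕ} (k h : Fin m → ℕ) (j : Fin m) : ℤ :=
  if j.val = 0 then (k j : ℤ)
  else (k j : ℤ) - ((k ⟨j.val - 1, by omega⟩ : ℤ) + (h ⟨j.val - 1, by omega⟩ : ℤ) - 1)

/-- The precision matrix `[var (y_1, …, y_n)]⁻¹`; the index `i : Fin n` stands for the time
`i + 1`. -/
def precision {Ω : Type*} [MeasurableSpace Ω] (P : Measure Ω) (y : ℕ → Ω → ℝ) (n : ℕ) :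
    Matrix (Fin n) (Fin n) ℝ :=
  (Matrix.of fun i j : Fin n => covariance (y (i.val + 1)) (y (j.val + 1)) P)⁻¹

/-! ### Spectral distributions and outliers of a sequence of real symmetric matrices -/

/-- The eigenvalues, with multiplicity, of a real symmetric matrix (all of its complex
eigenvalues are real, so the real roots of the characteristic polynomial are all of them). -/
def eigs {n : ℕ} (A : Matrix (Fin n) (Fin n) ℝ) : Multiset ℝ :=
  A.charpoly.roots

/-- The empirical spectral distribution `(1/n) ∑_i δ_{λ_i(A)}`. -/
def esd {n : ℕ} (A : Matrix (Fin n) (Fin n) ℝ) : Measure ℝ :=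
  (n : ENNReal)⁻¹ • ((eigs A).map fun x => Measure.dirac x).sum

/-- `μ` is the asymptotic spectral distribution of the sequence `A`: the empirical spectral
distributions converge weakly to the probability measure `μ`. -/
def HasASD (A : (n : ℕ) → Matrix (Fin n) (Fin n) ℝ) (μ : Measure ℝ) : Prop :=
  IsProbabilityMeasure μ ∧
    ∀ f : BoundedContinuousFunction ℝ ℝ,
      Tendsto (fun n => ∫ x, f x ∂(esd (A n))) atTop (𝓝 (∫ x, f x ∂μ))

/-- The outliers of a sequence `A` with asymptotic spectral distribution `μ`: the points whose
distance to the spectrum of `A n` tends to zero and which are outside the closed support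
of `μ`. -/
def outliers (A : (n : ℕ) → Matrix (Fin n) (Fin n) ℝ) (μ : Measure ℝ) : Set ℝ :=
  {x | Tendsto (fun n => Metric.infDist x (spectrum ℝ (A n))) atTop (𝓝 0) ∧
    x ∉ closure μ.support}

/-- Left outliers: those below the support. -/
def leftOutliers (A : (n : ℕ) → Matrix (Fin n) (Fin n) ℝ) (μ : Measure ℝ) : Set ℝ :=
  outliers A μ ∩ Set.Iio (sInf μ.support)

/-- Right outliers: those above the support. -/
def rightOutliers (A : (n : ℕ) → Matrix (Fin n) (Fin n) ℝ) (μ : Measure ℝ) : Set ℝ :=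
  outliers A μ ∩ Set.Ioi (sSup μ.support)

open Classical in
/-- The point `x` has multiplicity `r` for the sequence `A`: in every sufficiently small
neighbourhood of `x` the matrix `A n` has, for all large `n`, exactly `r` eigenvalues counted with
multiplicity. -/
def HasMultiplicity (A : (n : ℕ) → Matrix (Fin n) (Fin n) ℝ) (x : ℝ) (r : ℕ) : Prop :=
  ∃ δ₀ > 0, ∀ δ, 0 < δ → δ ≤ δ₀ →
    ∀ᶠ n in atTop, (eigs (A n)).countP (fun y => |y - x| < δ) = r

/-- The set `T` of outliers of `A` is, counted with multiplicity, the multiset `S`. -/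
def EqWithMultiplicity (A : (n : ℕ) → Matrix (Fin n) (Fin n) ℝ) (T : Set ℝ)
    (S : Multiset ℝ) : Prop :=
  (∀ x, x ∈ T ↔ x ∈ S) ∧ ∀ x ∈ T, HasMultiplicity A x (S.count x)

/-! ### The limit law and the explicit formulas -/

/-- The law `μ_ρ` of `1 + ρ² - 2 ρ cos U` with `U` uniform on `[0, 2π]`. -/
def limitLaw (ρ : ℝ) : Measure ℝ :=
  ((ENNReal.ofReal (2 * Real.pi))⁻¹ • volume.restrict (Set.Icc 0 (2 * Real.pi))).map
    fun x => 1 + ρ ^ 2 - 2 * ρ * Real.cos x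

/-- The smaller root `s`. -/
def sRoot (ρ ε : ℝ) : ℝ :=
  (ρ * ε * (ε + 2 * ρ) -
    Real.sqrt (ρ ^ 2 * ε ^ 2 * (ε + 2 * ρ) ^ 2 + 4 * ρ ^ 2 * (ε + ρ) ^ 2)) / (2 * (ε + ρ) ^ 2)

/-- The larger root `t`. -/
def tRoot (ρ ε : ℝ) : ℝ :=
  (ρ * ε * (ε + 2 * ρ) +
    Real.sqrt (ρ ^ 2 * ε ^ 2 * (ε + 2 * ρ) ^ 2 + 4 * ρ ^ 2 * (ε + ρ) ^ 2)) / (2 * (ε + ρ) ^ 2)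

/-- The map `x ↦ 1 + ρ² - ρ (x + x⁻¹)`. -/
def joukowski (ρ x : ℝ) : ℝ := 1 + ρ ^ 2 - ρ * (x + x⁻¹)

/-- The explicit left outlier `m` of the single structural change model. -/
def leftFormula (ρ ε : ℝ) : ℝ :=
  if ρ < 0 then joukowski ρ (sRoot ρ ε) else joukowski ρ (tRoot ρ ε)

/-- The explicit right outlier `M` of the single structural change model. -/
def rightFormula (ρ ε : ℝ) : ℝ :=
  if ρ < 0 then joukowski ρ (tRoot ρ ε) else joukowski ρ (sRoot ρ ε)

end

end SCM

namespace SCM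

open Matrix

/-! By `precision_eq`, `B_n = Cᵀ C` with `C` bidiagonal, so its quadratic form is `∑ (v_t - r_t
v_{t-1})²` with `v_0 = 0`. The outliers come from matching an upper and a lower count of
eigenvalues.

Upper count. For constant coefficient `ρ` the form lies between `(1 - |ρ|)²` and `(1 + |ρ|)²` times
`|v|²`. On the subspace `v_{k_j} = ρ v_{k_j - 1}`, of codimension at most `m`, the true form
dominates the constant one. On the subspace `v_{k_j} = r_{k_j} v_{k_j - 1}` it is dominated by it.
Hence at most `m` eigenvalues lie on either side of the support, for every `n` (`countP_eigs_lt_le`,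
`countP_eigs_gt_le`).

Lower count. With `R = ρ + ε_j`, a sequence decaying geometrically with ratio `x` away from `k_j` on
both sides solves the eigenvalue equation for `f(x)` exactly when `R² x² - ρ (R² - ρ²) x - ρ² = 0`.
Since `|ρ| < |R|` and `|ρ| < 1`, the roots are in `(-1, 1)` and of opposite signs; the sign of `ρ x`
decides on which side of the support `f(x)` lies. Truncated modes at distant breaks have disjoint
supports and small residuals, so each value attracts as many eigenvalues as there are breaks
producing it (`eventually_card_le_countP`). These counts already add up to `m`, so all of them are
equalities (`hasMultiplicity_of_bounds`).

Limit law. Plane waves of frequency `θ` satisfy the eigenvalue equation for `1 + ρ² - 2 ρ cos θ` up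
to an error bounded independently of `n` and `θ`. Averaging over `θ` with Parseval gives weak
convergence (`hasASD_of_coeff`). -/

/-! ### Counting eigenvalues of symmetric matrices -/

/-- An orthonormal eigenbasis of a real symmetric matrix, in terms of dot products. -/
theorem exists_eigenbasis {n : ℕ} {A : Matrix (Fin n) (Fin n) ℝ} (hA : A.IsHermitian) :
    ∃ (u : Fin n → Fin n → ℝ) (l : Fin n → ℝ), eigs A = Finset.univ.val.map l ∧
      (∀ v, ∑ i, (u i ⬝ᵥ v) ^ 2 = v ⬝ᵥ v) ∧ (∀ i v, u i ⬝ᵥ A *ᵥ v = l i * (u i ⬝ᵥ v)) ∧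
      ∀ i, u i ⬝ᵥ u i = 1 := by
  refine ⟨fun i => WithLp.ofLp (hA.eigenvectorBasis i), hA.eigenvalues, ?_, ?_, ?_, ?_⟩
  · simpa [Function.comp_def, eigs] using hA.roots_charpoly_eq_eigenvalues
  · intro v
    have h := hA.eigenvectorBasis.sum_sq_norm_inner_right (WithLp.toLp 2 v)
    rw [EuclideanSpace.real_norm_sq_eq] at h
    simp only [Real.norm_eq_abs, sq_abs] at h
    simp only [EuclideanSpace.inner_eq_star_dotProduct, star_trivial] at h
    simp only [dotProduct_comm _ v]
    rw [h]
    simp [dotProduct, sq]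
  · intro i v
    have h := hA.mulVec_eigenvectorBasis i
    have hT : Aᵀ = A := by simpa [IsHermitian, conjTranspose_eq_transpose_of_trivial] using hA
    rw [dotProduct_mulVec, ← mulVec_transpose, hT, h, smul_dotProduct, smul_eq_mul]
  · intro i
    have h := hA.eigenvectorBasis.orthonormal.1 i
    have h2 : ‖hA.eigenvectorBasis i‖ ^ 2 = 1 := by rw [h]; norm_num
    rw [EuclideanSpace.real_norm_sq_eq] at h2
    rw [← h2]
    simp [dotProduct, sq]

theorem countP_map_univ {n : ℕ} (l : Fin n → ℝ) (p : ℝ → Prop) [DecidablePred p] :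
    (Finset.univ.val.map l).countP p = (Finset.univ.filter fun i => p (l i)).card := by
  rw [Multiset.countP_map]; rfl

theorem exists_ne_zero_of_card_lt {ι κ : Type*} [Fintype ι] [Fintype κ]
    (f : (ι → ℝ) →ₗ[ℝ] (κ → ℝ)) (h : Fintype.card κ < Fintype.card ι) :
    ∃ v, v ≠ 0 ∧ f v = 0 := by
  have hk := LinearMap.ker_ne_bot_of_finrank_lt (f := f) (by simpa using h)
  obtain ⟨v, hv, hv0⟩ := (Submodule.ne_bot_iff _).1 hk
  exact ⟨v, hv0, hv⟩

/-- If the quadratic form of `A` minus `a` has sign `σ` on a subspace of codimension `m`, then at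
most `m` eigenvalues are strictly on the other side of `a`. -/
theorem countP_eigs_le {n m : ℕ} {A : Matrix (Fin n) (Fin n) ℝ} (hA : A.IsHermitian)
    (σ a : ℝ) (φ : Fin m → Fin n → ℝ)
    (h : ∀ v, (∀ j, φ j ⬝ᵥ v = 0) → 0 ≤ σ * (v ⬝ᵥ A *ᵥ v - a * (v ⬝ᵥ v)))
    (p : ℝ → Prop) [DecidablePred p] (hp : ∀ x, p x → σ * (x - a) < 0) :
    (eigs A).countP p ≤ m := by
  classical
  obtain ⟨u, l, he, hpar, hl, hu⟩ := exists_eigenbasis hA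
  rw [he, countP_map_univ]
  by_contra! hm
  set I := Finset.univ.filter fun i => p (l i) with hI
  -- There are `n - |I| + m < n` equations: a kernel vector lies in the span of the eigenvectors on
  -- the wrong side of `a` and satisfies all the constraints `φ j`.
  let f : (Fin n → ℝ) →ₗ[ℝ] ({i // i ∉ I} ⊕ Fin m → ℝ) :=
    LinearMap.pi fun s => s.elim (fun i : {i // i ∉ I} => dotProductBilin ℝ ℝ (u i.1))
      (fun j => dotProductBilin ℝ ℝ (φ j))
  obtain ⟨v, hv0, hv⟩ := exists_ne_zero_of_card_lt f (by
    have h1 : Fintype.card {i // i ∉ I} = n - I.card := by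
      rw [Fintype.card_subtype_compl]; simp
    have h2 : I.card ≤ n := by simpa using Finset.card_le_univ I
    simp only [Fintype.card_sum, h1, Fintype.card_fin]; omega)
  have hu0 : ∀ i, i ∉ I → u i ⬝ᵥ v = 0 := fun i hi => by
    simpa [f] using congrFun hv (Sum.inl ⟨i, hi⟩)
  have hφ : ∀ j, φ j ⬝ᵥ v = 0 := fun j => by simpa [f] using congrFun hv (Sum.inr j)
  -- Parseval is available for squares only; polarise using `v`, `A v` and `v + A v`.
  have hpol : v ⬝ᵥ A *ᵥ v = ∑ i, l i * (u i ⬝ᵥ v) ^ 2 := by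
    have h1 := hpar (v + A *ᵥ v)
    have h2 := hpar v
    have h3 := hpar (A *ᵥ v)
    simp only [dotProduct_add, add_dotProduct, hl] at h1 h3
    rw [dotProduct_comm (A *ᵥ v) v, ← h2, ← h3] at h1
    have h4 : ∑ i, (u i ⬝ᵥ v + l i * (u i ⬝ᵥ v)) ^ 2 = ∑ i, (u i ⬝ᵥ v) ^ 2
        + 2 * ∑ i, l i * (u i ⬝ᵥ v) ^ 2 + ∑ i, (l i * (u i ⬝ᵥ v)) ^ 2 := by
      rw [Finset.mul_sum, ← Finset.sum_add_distrib, ← Finset.sum_add_distrib]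
      exact Finset.sum_congr rfl fun i _ => by ring
    linarith
  have h1 := h v hφ
  rw [hpol, ← hpar, Finset.mul_sum, ← Finset.sum_sub_distrib, Finset.mul_sum] at h1
  have hterm : ∀ i, σ * (l i * (u i ⬝ᵥ v) ^ 2 - a * (u i ⬝ᵥ v) ^ 2) ≤ 0 := by
    intro i
    by_cases hi : i ∈ I
    · have := hp _ (Finset.mem_filter.1 hi).2
      nlinarith [sq_nonneg (u i ⬝ᵥ v)]
    · simp [hu0 i hi]
  have hz := (Finset.sum_eq_zero_iff_of_nonpos fun i _ => hterm i).1
    (le_antisymm (Finset.sum_nonpos fun i _ => hterm i) h1)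
  have hall : ∀ i, u i ⬝ᵥ v = 0 := by
    intro i
    by_cases hi : i ∈ I
    · have h2 := hp _ (Finset.mem_filter.1 hi).2
      have h3 : σ * (l i - a) * (u i ⬝ᵥ v) ^ 2 = 0 := by
        rw [← hz i (Finset.mem_univ i)]; ring
      rcases mul_eq_zero.1 h3 with h4 | h4
      · exact absurd h4 h2.ne
      · exact pow_eq_zero_iff (two_ne_zero) |>.1 h4
    · exact hu0 i hi
  have h5 := hpar v
  simp only [hall] at h5
  exact hv0 (dotProduct_self_eq_zero.1 (by simpa using h5.symm))

/-- Mutually orthogonal quasimodes with mutually orthogonal residuals force as many eigenvalues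
near `x`. -/
theorem card_le_countP_eigs {n : ℕ} {J : Type*} [Fintype J]
    {A : Matrix (Fin n) (Fin n) ℝ} (hA : A.IsHermitian) (x δ : ℝ)
    (w g : J → Fin n → ℝ) (hg : ∀ j, A *ᵥ w j - x • w j = g j)
    (hw : ∀ i j, i ≠ j → w i ⬝ᵥ w j = 0) (hg0 : ∀ i j, i ≠ j → g i ⬝ᵥ g j = 0)
    (hlt : ∀ j, g j ⬝ᵥ g j < δ ^ 2 * (w j ⬝ᵥ w j))
    (p : ℝ → Prop) [DecidablePred p] (hp : ∀ y, ¬ p y → δ ^ 2 ≤ (y - x) ^ 2) :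
    Fintype.card J ≤ (eigs A).countP p := by
  classical
  obtain ⟨u, l, he, hpar, hl, hu⟩ := exists_eigenbasis hA
  rw [he, countP_map_univ]
  by_contra! hm
  set I := Finset.univ.filter fun i => p (l i) with hI
  -- With fewer than `|J|` eigenvalues near `x`, some nonzero combination of the quasimodes is
  -- orthogonal to all their eigenvectors. `A - x` then stretches it by at least `δ`, while the
  -- orthogonality of the `w j` and of the `g j` makes the stretch less than `δ`.
  let f : (J → ℝ) →ₗ[ℝ] ({i // i ∈ I} → ℝ) :=
    LinearMap.pi fun i => ∑ j, (u i ⬝ᵥ w j) • LinearMap.proj j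
  obtain ⟨c, hc0, hc⟩ := exists_ne_zero_of_card_lt f (by simpa using hm)
  set v : Fin n → ℝ := ∑ j, c j • w j with hv
  have hu0 : ∀ i ∈ I, u i ⬝ᵥ v = 0 := fun i hi => by
    have := congrFun hc ⟨i, hi⟩
    simpa [f, hv, dotProduct_sum, mul_comm] using this
  have hgv : A *ᵥ v - x • v = ∑ j, c j • g j := by
    rw [hv, mulVec_sum, Finset.smul_sum, ← Finset.sum_sub_distrib]
    refine Finset.sum_congr rfl fun j _ => ?_
    rw [mulVec_smul, ← hg, smul_sub, smul_comm]
  have horth : ∀ q : J → Fin n → ℝ, (∀ i j, i ≠ j → q i ⬝ᵥ q j = 0) →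
      (∑ j, c j • q j) ⬝ᵥ (∑ j, c j • q j) = ∑ j, c j ^ 2 * (q j ⬝ᵥ q j) := by
    intro q hq
    simp only [sum_dotProduct, dotProduct_sum, smul_dotProduct, dotProduct_smul, smul_eq_mul]
    refine Finset.sum_congr rfl fun j _ => ?_
    rw [Finset.sum_eq_single j]
    · ring
    · intro i _ hi; simp [hq i j hi]
    · simp
  have h1 : δ ^ 2 * (v ⬝ᵥ v) ≤ (A *ᵥ v - x • v) ⬝ᵥ (A *ᵥ v - x • v) := by
    rw [← hpar, ← hpar, Finset.mul_sum]
    refine Finset.sum_le_sum fun i _ => ?_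
    rw [dotProduct_sub, hl, dotProduct_smul, smul_eq_mul]
    by_cases hi : i ∈ I
    · simp [hu0 i hi]
    · have := hp (l i) (by simpa [hI] using hi)
      nlinarith [sq_nonneg (u i ⬝ᵥ v)]
  rw [hgv, horth g hg0, hv, horth w hw, Finset.mul_sum] at h1
  obtain ⟨j₀, hj₀⟩ := Function.ne_iff.1 hc0
  refine absurd h1 (not_le.2 (Finset.sum_lt_sum (fun j _ => ?_) ⟨j₀, Finset.mem_univ _, ?_⟩))
  · nlinarith [hlt j, sq_nonneg (c j)]
  · have : 0 < c j₀ ^ 2 := by have : c j₀ ≠ 0 := hj₀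
                              positivity
    nlinarith [hlt j₀]

/-! ### The bidiagonal matrix of the recursion -/

/-- The bidiagonal matrix `(y_1, …, y_n) ↦ (z_1, …, z_n)` of the recursion
`z_t = y_t - r_t y_{t-1}`. -/
def arMatrix (r : ℕ → ℝ) (n : ℕ) : Matrix (Fin n) (Fin n) ℝ :=
  Matrix.of fun i j => (if j = i then 1 else 0) - (if j.val + 1 = i.val then r (i.val + 1) else 0)

theorem sum_ite_val_succ_eq {n : ℕ} (i : Fin n) (f : ℕ → ℝ) (hf : f 0 = 0) :
    ∑ j : Fin n, (if j.val + 1 = i.val then f (j.val + 1) else 0) = f i.val := by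
  rcases Nat.eq_zero_or_pos i.val with h | h
  · simp [h, hf]
  · rw [Finset.sum_eq_single (⟨i.val - 1, by omega⟩ : Fin n)]
    · simp [Nat.sub_add_cancel h]
    · intro j _ hj
      rw [if_neg]
      intro h2; apply hj; ext; simp; omega
    · simp

theorem sum_ite_succ_eq_val {n : ℕ} (i : Fin n) (f : ℕ → ℝ) :
    ∑ j : Fin n, (if i.val + 1 = j.val then f j.val else 0) =
      if i.val + 1 < n then f (i.val + 1) else 0 := by
  split_ifs with h
  · rw [Finset.sum_eq_single (⟨i.val + 1, h⟩ : Fin n)]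
    · simp
    · intro j _ hj
      rw [if_neg]
      intro h2; apply hj; ext; simp; omega
    · simp
  · refine Finset.sum_eq_zero fun j _ => if_neg (by omega)

theorem arMatrix_mulVec (r : ℕ → ℝ) (n : ℕ) (v : ℕ → ℝ) (hv : v 0 = 0) :
    arMatrix r n *ᵥ (fun j => v (j.val + 1)) =
      fun i => v (i.val + 1) - r (i.val + 1) * v i.val := by
  ext i
  have h := sum_ite_val_succ_eq i (fun t => r (i.val + 1) * v t) (by simp [hv])
  simp only [mulVec, dotProduct, arMatrix, of_apply, sub_mul, Finset.sum_sub_distrib, ite_mul,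
    zero_mul, one_mul, Finset.sum_ite_eq', Finset.mem_univ, if_true]
  rw [h]

theorem arMatrix_transpose_mulVec (r : ℕ → ℝ) (n : ℕ) (u : ℕ → ℝ) :
    (arMatrix r n)ᵀ *ᵥ (fun j => u (j.val + 1)) =
      fun i => u (i.val + 1) - if i.val + 1 < n then r (i.val + 2) * u (i.val + 2) else 0 := by
  ext i
  have h := sum_ite_succ_eq_val i (fun t => r (t + 1) * u (t + 1))
  simp only [mulVec, dotProduct, arMatrix, transpose_apply, of_apply, sub_mul,
    Finset.sum_sub_distrib, ite_mul, zero_mul, one_mul, Finset.sum_ite_eq, Finset.mem_univ,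
    if_true]
  rw [h]

/-- Action of `Cᵀ C` on a sequence, in terms of `u_t = v_t - r_t v_{t-1}`. -/
theorem transpose_mul_arMatrix_mulVec (r : ℕ → ℝ) (n : ℕ) (v : ℕ → ℝ) (hv : v 0 = 0) (i : Fin n) :
    (((arMatrix r n)ᵀ * arMatrix r n) *ᵥ (fun j => v (j.val + 1))) i =
      (v (i.val + 1) - r (i.val + 1) * v i.val) - if i.val + 1 < n then
        r (i.val + 2) * (v (i.val + 2) - r (i.val + 2) * v (i.val + 1)) else 0 := by
  rw [← mulVec_mulVec, arMatrix_mulVec r n v hv]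
  exact congrFun (arMatrix_transpose_mulVec r n fun t => v t - r t * v (t - 1)) i

theorem isHermitian_transpose_mul_arMatrix (r : ℕ → ℝ) (n : ℕ) :
    ((arMatrix r n)ᵀ * arMatrix r n).IsHermitian := by
  simp [IsHermitian, conjTranspose_eq_transpose_of_trivial]

theorem dotProduct_transpose_mul_arMatrix (r : ℕ → ℝ) (n : ℕ) (v : ℕ → ℝ) (hv : v 0 = 0) :
    (fun j : Fin n => v (j.val + 1)) ⬝ᵥ ((arMatrix r n)ᵀ * arMatrix r n) *ᵥ
      (fun j => v (j.val + 1)) = ∑ t ∈ Finset.range n, (v (t + 1) - r (t + 1) * v t) ^ 2 := by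
  rw [← mulVec_mulVec, dotProduct_mulVec, vecMul_transpose, arMatrix_mulVec r n v hv,
    ← Fin.sum_univ_eq_sum_range (fun t => (v (t + 1) - r (t + 1) * v t) ^ 2)]
  simp [dotProduct, sq]

/-! ### Factorisation of the precision matrix -/

section Covariance

variable {Ω : Type*} [MeasurableSpace Ω] {P : Measure Ω} {z : ℕ → Ω → ℝ}

theorem arProcess_memLp (hz : IsUnitWhiteNoise P z) (r : ℕ → ℝ) (t : ℕ) :
    MemLp (arProcess r z t) 2 P := by
  induction t with
  | zero => exact MemLp.zero
  | succ t ih => exact (ih.const_mul (r (t + 1))).add (hz.memLp (t + 1))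

theorem covariance_arProcess_succ_left [IsProbabilityMeasure P] (hz : IsUnitWhiteNoise P z)
    (r : ℕ → ℝ) (t : ℕ) {X : Ω → ℝ} (hX : MemLp X 2 P) :
    covariance (arProcess r z (t + 1)) X P =
      r (t + 1) * covariance (arProcess r z t) X P + covariance (z (t + 1)) X P := by
  have h : arProcess r z (t + 1) = (fun ω => r (t + 1) * arProcess r z t ω) + z (t + 1) := rfl
  rw [h, covariance_add_left ((arProcess_memLp hz r t).const_mul (r (t + 1)))
    (hz.memLp (t + 1)) hX, covariance_const_mul_left]

theorem covariance_arProcess_zero (r : ℕ → ℝ) (X : Ω → ℝ) :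
    covariance (arProcess r z 0) X P = 0 :=
  covariance_zero_left

/-- Since `C y = z` and `var z = 1`, the covariance matrix `S` of `y` satisfies `C S Cᵀ = 1`.
Applying `C` to one index at a time turns each `y` into a `z` through the recursion, with no formula
for `S`. -/
theorem precision_eq [IsProbabilityMeasure P] (hz : IsUnitWhiteNoise P z) (r : ℕ → ℝ) (n : ℕ) :
    precision P (arProcess r z) n = (arMatrix r n)ᵀ * arMatrix r n := by
  set S : Matrix (Fin n) (Fin n) ℝ := Matrix.of fun i j : Fin n =>
    covariance (arProcess r z (i.val + 1)) (arProcess r z (j.val + 1)) P with hS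
  have h1 : arMatrix r n * S =
      Matrix.of fun i j : Fin n => covariance (arProcess r z (j.val + 1)) (z (i.val + 1)) P := by
    ext i j
    have := congrFun (arMatrix_mulVec r n
      (fun t => covariance (arProcess r z t) (arProcess r z (j.val + 1)) P)
      (covariance_arProcess_zero r _)) i
    refine Eq.trans (by rfl) (this.trans ?_)
    rw [covariance_arProcess_succ_left hz r _ (arProcess_memLp hz r _)]
    simp [covariance_comm (z (i.val + 1))]
  have h2 : arMatrix r n * S * (arMatrix r n)ᵀ = 1 := by
    rw [h1]
    ext i j
    have := congrFun (arMatrix_mulVec r n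
      (fun t => covariance (arProcess r z t) (z (i.val + 1)) P)
      (covariance_arProcess_zero r _)) j
    have h3 : (Matrix.of (fun i j : Fin n =>
        covariance (arProcess r z (j.val + 1)) (z (i.val + 1)) P) * (arMatrix r n)ᵀ) i j =
        (arMatrix r n *ᵥ fun a => covariance (arProcess r z (a.val + 1)) (z (i.val + 1)) P) j := by
      simp [Matrix.mul_apply, mulVec, dotProduct, mul_comm]
    rw [h3, this, covariance_arProcess_succ_left hz r _ (hz.memLp _)]
    by_cases hij : i = j
    · subst hij
      rw [covariance_self (hz.memLp _).1.aemeasurable, hz.variance_one]; simp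
    · have hij' : (j.val + 1) ≠ i.val + 1 := fun h => hij (by ext; omega)
      rw [hz.uncorrelated _ _ hij', Matrix.one_apply_ne hij]; ring
  have h4 : S * ((arMatrix r n)ᵀ * arMatrix r n) = 1 := by
    rw [← Matrix.mul_assoc]
    rw [Matrix.mul_assoc] at h2
    exact mul_eq_one_comm.1 h2
  exact Matrix.inv_eq_right_inv h4

end Covariance

/-! ### Quadratic form bounds and the upper count -/

theorem sum_range_sq_le (n : ℕ) (v : ℕ → ℝ) (hv : v 0 = 0) :
    ∑ t ∈ Finset.range n, v t ^ 2 ≤ ∑ t ∈ Finset.range n, v (t + 1) ^ 2 := by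
  have h := Finset.sum_range_succ (fun t => v t ^ 2) n
  have h' := Finset.sum_range_succ' (fun t => v t ^ 2) n
  simp only [hv] at h'
  nlinarith [sq_nonneg (v n)]

/-- Termwise the slack is `|ρ| (v_{t+1} ∓ v_t)²`, with the sign of `ρ`; summing, the shift costs
nothing because `v 0 = 0`. -/
theorem le_sum_sq_sub (ρ : ℝ) (hρ : |ρ| < 1) (n : ℕ) (v : ℕ → ℝ) (hv : v 0 = 0) :
    (1 - |ρ|) ^ 2 * ∑ t ∈ Finset.range n, v (t + 1) ^ 2 ≤
      ∑ t ∈ Finset.range n, (v (t + 1) - ρ * v t) ^ 2 := by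
  have h1 : ∑ t ∈ Finset.range n, ((1 - |ρ|) * v (t + 1) ^ 2 - |ρ| * (1 - |ρ|) * v t ^ 2) ≤
      ∑ t ∈ Finset.range n, (v (t + 1) - ρ * v t) ^ 2 := by
    refine Finset.sum_le_sum fun t _ => ?_
    rcases abs_cases ρ with ⟨h, h'⟩ | ⟨h, h'⟩ <;> rw [h]
    · nlinarith [mul_nonneg h' (sq_nonneg (v (t + 1) - v t))]
    · nlinarith [mul_nonneg (neg_nonneg.2 h'.le) (sq_nonneg (v (t + 1) + v t))]
  rw [Finset.sum_sub_distrib, ← Finset.mul_sum, ← Finset.mul_sum] at h1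
  nlinarith [mul_le_mul_of_nonneg_left (sum_range_sq_le n v hv)
    (mul_nonneg (abs_nonneg ρ) (sub_nonneg.2 hρ.le))]

theorem sum_sq_sub_le (ρ : ℝ) (n : ℕ) (v : ℕ → ℝ) (hv : v 0 = 0) :
    ∑ t ∈ Finset.range n, (v (t + 1) - ρ * v t) ^ 2 ≤
      (1 + |ρ|) ^ 2 * ∑ t ∈ Finset.range n, v (t + 1) ^ 2 := by
  have h1 : ∑ t ∈ Finset.range n, (v (t + 1) - ρ * v t) ^ 2 ≤
      ∑ t ∈ Finset.range n, ((1 + |ρ|) * v (t + 1) ^ 2 + |ρ| * (1 + |ρ|) * v t ^ 2) := by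
    refine Finset.sum_le_sum fun t _ => ?_
    rcases abs_cases ρ with ⟨h, h'⟩ | ⟨h, h'⟩ <;> rw [h]
    · nlinarith [mul_nonneg h' (sq_nonneg (v (t + 1) + v t))]
    · nlinarith [mul_nonneg (neg_nonneg.2 h'.le) (sq_nonneg (v (t + 1) - v t))]
  rw [Finset.sum_add_distrib, ← Finset.mul_sum, ← Finset.mul_sum] at h1
  nlinarith [mul_le_mul_of_nonneg_left (sum_range_sq_le n v hv)
    (mul_nonneg (abs_nonneg ρ) (add_nonneg zero_le_one (abs_nonneg ρ)))]

/-- The sequence `0, v_1, …, v_n, 0, …` of a vector. -/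
def toSeq {n : ℕ} (v : Fin n → ℝ) (t : ℕ) : ℝ :=
  if h : 0 < t ∧ t - 1 < n then v ⟨t - 1, h.2⟩ else 0

@[simp] theorem toSeq_zero {n : ℕ} (v : Fin n → ℝ) : toSeq v 0 = 0 := by simp [toSeq]

theorem toSeq_succ {n : ℕ} (v : Fin n → ℝ) : (fun i : Fin n => toSeq v (i.val + 1)) = v := by
  ext i; simp [toSeq]

/-- A linear form on vectors evaluating to `v_t - s v_{t-1}`. -/
theorem exists_dotProduct_eq (n : ℕ) (s : ℝ) (t : ℕ) : ∃ φ : Fin n → ℝ, ∀ v : Fin n → ℝ,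
    φ ⬝ᵥ v = toSeq v t - s * toSeq v (t - 1) := by
  have h : ∀ t, ∃ φ : Fin n → ℝ, ∀ v : Fin n → ℝ, φ ⬝ᵥ v = toSeq v t := by
    intro t
    by_cases h : 0 < t ∧ t - 1 < n
    · exact ⟨Pi.single ⟨t - 1, h.2⟩ 1, fun v => by simp [toSeq, h]⟩
    · exact ⟨0, fun v => by simp [toSeq, h]⟩
  obtain ⟨φ, hφ⟩ := h t
  obtain ⟨ψ, hψ⟩ := h (t - 1)
  exact ⟨φ - s • ψ, fun v => by rw [sub_dotProduct, smul_dotProduct, hφ, hψ, smul_eq_mul]⟩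

theorem countP_eigs_lt_le {m : ℕ} (ρ : ℝ) (hρ : |ρ| < 1) (r : ℕ → ℝ) (k : Fin m → ℕ)
    (hr : ∀ t, (∀ j, t ≠ k j) → r t = ρ) (n : ℕ) (p : ℝ → Prop) [DecidablePred p]
    (hp : ∀ x, p x → x < (1 - |ρ|) ^ 2) :
    (eigs ((arMatrix r n)ᵀ * arMatrix r n)).countP p ≤ m := by
  -- Imposing `v_{k_j} = ρ v_{k_j - 1}` kills the terms of the constant-coefficient form at the
  -- breaks; the other terms of the two forms agree.
  choose φ hφ using fun j => exists_dotProduct_eq n ρ (k j)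
  refine countP_eigs_le (isHermitian_transpose_mul_arMatrix r n) 1 ((1 - |ρ|) ^ 2) φ ?_ p
    fun x hx => by linarith [hp x hx]
  intro v hv
  have h1 := dotProduct_transpose_mul_arMatrix r n (toSeq v) (toSeq_zero v)
  have h2 := le_sum_sq_sub ρ hρ n (toSeq v) (toSeq_zero v)
  have h3 : v ⬝ᵥ v = ∑ t ∈ Finset.range n, toSeq v (t + 1) ^ 2 := by
    rw [← Fin.sum_univ_eq_sum_range (fun t => toSeq v (t + 1) ^ 2)]
    conv_lhs => rw [← toSeq_succ v]
    simp [dotProduct, sq]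
  rw [toSeq_succ] at h1
  have h4 : ∑ t ∈ Finset.range n, (toSeq v (t + 1) - ρ * toSeq v t) ^ 2 ≤
      ∑ t ∈ Finset.range n, (toSeq v (t + 1) - r (t + 1) * toSeq v t) ^ 2 := by
    refine Finset.sum_le_sum fun t _ => ?_
    by_cases ht : ∃ j, t + 1 = k j
    · obtain ⟨j, hj⟩ := ht
      have := hφ j v
      rw [hv, ← hj, Nat.add_sub_cancel] at this
      rw [← this, zero_pow two_ne_zero]
      exact sq_nonneg _
    · rw [hr (t + 1) (by push Not at ht; exact ht)]
  rw [h1, h3]; linarith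

theorem countP_eigs_gt_le {m : ℕ} (ρ : ℝ) (r : ℕ → ℝ) (k : Fin m → ℕ)
    (hr : ∀ t, (∀ j, t ≠ k j) → r t = ρ) (n : ℕ) (p : ℝ → Prop) [DecidablePred p]
    (hp : ∀ x, p x → (1 + |ρ|) ^ 2 < x) :
    (eigs ((arMatrix r n)ᵀ * arMatrix r n)).countP p ≤ m := by
  -- Here the true form must be the smaller one, so its own terms at the breaks are killed.
  choose φ hφ using fun j => exists_dotProduct_eq n (r (k j)) (k j)
  refine countP_eigs_le (isHermitian_transpose_mul_arMatrix r n) (-1) ((1 + |ρ|) ^ 2) φ ?_ p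
    fun x hx => by linarith [hp x hx]
  intro v hv
  have h1 := dotProduct_transpose_mul_arMatrix r n (toSeq v) (toSeq_zero v)
  have h2 := sum_sq_sub_le ρ n (toSeq v) (toSeq_zero v)
  have h3 : v ⬝ᵥ v = ∑ t ∈ Finset.range n, toSeq v (t + 1) ^ 2 := by
    rw [← Fin.sum_univ_eq_sum_range (fun t => toSeq v (t + 1) ^ 2)]
    conv_lhs => rw [← toSeq_succ v]
    simp [dotProduct, sq]
  rw [toSeq_succ] at h1
  have h4 : ∑ t ∈ Finset.range n, (toSeq v (t + 1) - r (t + 1) * toSeq v t) ^ 2 ≤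
      ∑ t ∈ Finset.range n, (toSeq v (t + 1) - ρ * toSeq v t) ^ 2 := by
    refine Finset.sum_le_sum fun t _ => ?_
    by_cases ht : ∃ j, t + 1 = k j
    · obtain ⟨j, hj⟩ := ht
      have := hφ j v
      rw [hv, ← hj, Nat.add_sub_cancel] at this
      rw [← this, zero_pow two_ne_zero]
      exact sq_nonneg _
    · rw [hr (t + 1) (by push Not at ht; exact ht)]
  rw [h1, h3]; linarith

/-! ### The limit law and its support -/

section LimitLaw

theorem integral_limitLaw (ρ : ℝ) (f : BoundedContinuousFunction ℝ ℝ) :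
    ∫ x, f x ∂(limitLaw ρ) =
      (2 * Real.pi)⁻¹ * ∫ θ in (0 : ℝ)..2 * Real.pi, f (1 + ρ ^ 2 - 2 * ρ * Real.cos θ) := by
  rw [limitLaw, integral_map (by fun_prop) f.continuous.aestronglyMeasurable,
    integral_smul_measure, integral_Icc_eq_integral_Ioc,
    ← intervalIntegral.integral_of_le Real.two_pi_pos.le, smul_eq_mul, ENNReal.toReal_inv,
    ENNReal.toReal_ofReal Real.two_pi_pos.le]

instance isProbabilityMeasure_limitLaw (ρ : ℝ) : IsProbabilityMeasure (limitLaw ρ) := by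
  constructor
  rw [limitLaw, Measure.map_apply (by fun_prop) MeasurableSet.univ]
  simp only [Set.preimage_univ, Measure.smul_apply, Measure.restrict_apply_univ, Real.volume_Icc,
    sub_zero, smul_eq_mul]
  exact ENNReal.inv_mul_cancel (by simpa using Real.pi_pos) ENNReal.ofReal_ne_top

theorem mem_Icc_symbol (ρ θ : ℝ) : 1 + ρ ^ 2 - 2 * ρ * Real.cos θ ∈
    Set.Icc ((1 - |ρ|) ^ 2) ((1 + |ρ|) ^ 2) := by
  have h1 := Real.neg_one_le_cos θ
  have h2 := Real.cos_le_one θ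
  constructor <;> rcases abs_cases ρ with ⟨h, h'⟩ | ⟨h, h'⟩ <;> rw [h] <;> nlinarith

theorem exists_symbol_eq {ρ x : ℝ} (hρ0 : ρ ≠ 0)
    (hx : x ∈ Set.Icc ((1 - |ρ|) ^ 2) ((1 + |ρ|) ^ 2)) :
    ∃ θ ∈ Set.Icc 0 (2 * Real.pi), 1 + ρ ^ 2 - 2 * ρ * Real.cos θ = x := by
  set c := (1 + ρ ^ 2 - x) / (2 * ρ) with hc
  have hcx : 2 * ρ * c = 1 + ρ ^ 2 - x := by rw [hc]; field_simp
  have habs : |c| ≤ 1 := by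
    rw [hc, abs_div, div_le_one (by positivity), abs_le, abs_mul, abs_two]
    obtain ⟨h1, h2⟩ := hx
    have := sq_abs ρ
    constructor <;> nlinarith
  refine ⟨Real.arccos c, ⟨Real.arccos_nonneg c, ?_⟩, ?_⟩
  · linarith [Real.arccos_le_pi c, Real.pi_pos]
  · rw [Real.cos_arccos (abs_le.1 habs).1 (abs_le.1 habs).2, hcx]; ring

theorem support_limitLaw {ρ : ℝ} (hρ0 : ρ ≠ 0) :
    (limitLaw ρ).support = Set.Icc ((1 - |ρ|) ^ 2) ((1 + |ρ|) ^ 2) := by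
  have hcont : Continuous fun x : ℝ => 1 + ρ ^ 2 - 2 * ρ * Real.cos x := by fun_prop
  apply Set.Subset.antisymm
  · refine Measure.support_subset_of_isClosed isClosed_Icc ?_
    rw [mem_ae_iff, limitLaw, Measure.map_apply (by fun_prop) measurableSet_Icc.compl]
    convert measure_empty
    · ext θ; simpa using mem_Icc_symbol ρ θ
    · infer_instance
  · intro x hx
    rw [Measure.support_eq_forall_isOpen]
    intro U hxU hU
    obtain ⟨θ, hθ, rfl⟩ := exists_symbol_eq hρ0 hx
    rw [limitLaw, Measure.map_apply (by fun_prop) hU.measurableSet]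
    have hO := hU.preimage hcont
    rw [Measure.smul_apply, Measure.restrict_apply hO.measurableSet, smul_eq_mul]
    refine ENNReal.mul_pos (ENNReal.inv_ne_zero.2 ENNReal.ofReal_ne_top) (ne_of_gt ?_)
    -- At the endpoints `0` and `2π` the preimage of `U` need not be a neighbourhood inside the
    -- interval, but it still meets the open interval.
    have hcl : θ ∈ closure (Set.Ioo 0 (2 * Real.pi)) := by
      rwa [closure_Ioo Real.two_pi_pos.ne]
    have hne := mem_closure_iff.1 hcl _ hO hxU
    refine lt_of_lt_of_le ((hO.inter isOpen_Ioo).measure_pos volume hne) (measure_mono ?_)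
    exact Set.inter_subset_inter_right _ Set.Ioo_subset_Icc_self

end LimitLaw

/-! ### Convergence of the spectral distributions -/

section SpectralDistribution

theorem sum_ite_val_add_eq_le (n a b : ℕ) :
    ∑ i : Fin n, (if i.val + a = b then (1 : ℝ) else 0) ≤ 1 := by
  rw [Finset.sum_boole]
  have : (Finset.univ.filter fun i : Fin n => i.val + a = b).card ≤ 1 :=
    Finset.card_le_one.2 fun i hi j hj => by
      simp only [Finset.mem_filter, Finset.mem_univ, true_and] at hi hj
      ext; omega
  exact_mod_cast this

/-- A plane wave is an eigenvector of `Cᵀ C` up to an error of bounded norm. -/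
theorem residual_plane_wave_le {m : ℕ} {ρ R : ℝ} (hρ : |ρ| ≤ R) (r : ℕ → ℝ) (k : Fin m → ℕ)
    (hr : ∀ t, (∀ j, t ≠ k j) → r t = ρ) (hR : ∀ t, |r t| ≤ R) (n : ℕ) {c : ℝ} (hc : |c| ≤ 1)
    (v : ℕ → ℝ) (hv0 : v 0 = 0) (hv1 : ∀ t, |v t| ≤ 1)
    (hv : ∀ t, 1 ≤ t → v (t + 2) + v t = 2 * c * v (t + 1)) (w : Fin n → ℝ)
    (hw : w = ((arMatrix r n)ᵀ * arMatrix r n) *ᵥ (fun j => v (j.val + 1)) -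
      (1 + ρ ^ 2 - 2 * ρ * c) • fun j : Fin n => v (j.val + 1)) :
    w ⬝ᵥ w ≤ (2 * (1 + R) ^ 2) ^ 2 * (2 + 2 * m) := by
  have hR0 : 0 ≤ R := (abs_nonneg ρ).trans hρ
  have hwi : ∀ i, w i = (v (i.val + 1) - r (i.val + 1) * v i.val) - (if i.val + 1 < n then
        r (i.val + 2) * (v (i.val + 2) - r (i.val + 2) * v (i.val + 1)) else 0) -
        (1 + ρ ^ 2 - 2 * ρ * c) * v (i.val + 1) := fun i => by
    rw [hw, Pi.sub_apply, transpose_mul_arMatrix_mulVec r n v hv0]; simp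
  have hu : ∀ s t t', |v t - r s * v t'| ≤ 1 + R := fun s t t' => by
    refine (abs_sub _ _).trans (add_le_add (hv1 t) ?_)
    rw [abs_mul]
    nlinarith [hR s, hv1 t', abs_nonneg (v t'), abs_nonneg (r s)]
  have hbound : ∀ i, |w i| ≤ 2 * (1 + R) ^ 2 := by
    intro i
    rw [hwi]
    have h1 := hu (i.val + 1) (i.val + 1) i.val
    have h2 : |(if i.val + 1 < n then
        r (i.val + 2) * (v (i.val + 2) - r (i.val + 2) * v (i.val + 1)) else 0)| ≤
        R * (1 + R) := by
      split_ifs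
      · rw [abs_mul]
        exact mul_le_mul (hR _) (hu _ _ _) (abs_nonneg _) hR0
      · rw [abs_zero]; positivity
    have h3 : |(1 + ρ ^ 2 - 2 * ρ * c) * v (i.val + 1)| ≤ (1 + R) ^ 2 := by
      rw [abs_mul]
      have h4 : |1 + ρ ^ 2 - 2 * ρ * c| ≤ (1 + R) ^ 2 := by
        obtain ⟨hρ1, hρ2⟩ := abs_le.1 hρ
        obtain ⟨hc1, hc2⟩ := abs_le.1 hc
        have h5 : |2 * ρ * c| ≤ 2 * R := by
          rw [abs_mul, abs_mul, abs_two]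
          nlinarith [abs_nonneg c, abs_nonneg ρ]
        obtain ⟨h5, h6⟩ := abs_le.1 h5
        rw [abs_le]
        constructor <;> nlinarith
      calc _ ≤ (1 + R) ^ 2 * 1 := mul_le_mul h4 (hv1 _) (abs_nonneg _) (by positivity)
        _ = _ := mul_one _
    refine (abs_sub _ _).trans ?_
    have h6 := abs_sub (v (i.val + 1) - r (i.val + 1) * v i.val) (if i.val + 1 < n then
        r (i.val + 2) * (v (i.val + 2) - r (i.val + 2) * v (i.val + 1)) else 0)
    nlinarith
  -- The residual lives on at most `2 + 2m` entries: the first (where `v 0 = 0` may break the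
  -- recurrence), the last, and those of times `k j` and `k j - 1`.
  have hterm : ∀ i, w i * w i ≤ (2 * (1 + R) ^ 2) ^ 2 *
      ((if i.val + 0 = 0 then 1 else 0) + (if i.val + 1 = n then 1 else 0) +
        ∑ j, ((if i.val + 1 = k j then 1 else 0) + (if i.val + 2 = k j then 1 else 0))) := by
    intro i
    have hnn : ∀ j, (0 : ℝ) ≤
        (if i.val + 1 = k j then 1 else 0) + (if i.val + 2 = k j then 1 else 0) := fun j => by
      split_ifs <;> norm_num
    have hsum := Finset.sum_nonneg fun j (_ : j ∈ Finset.univ) => hnn j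
    by_cases hex : i.val = 0 ∨ i.val + 1 = n ∨ ∃ j, i.val + 1 = k j ∨ i.val + 2 = k j
    · have h1 : (1 : ℝ) ≤ (if i.val + 0 = 0 then 1 else 0) + (if i.val + 1 = n then 1 else 0) +
          ∑ j, ((if i.val + 1 = k j then 1 else 0) + (if i.val + 2 = k j then 1 else 0)) := by
        rcases hex with h | h | ⟨j, h⟩
        · rw [if_pos (show i.val + 0 = 0 from h)]; split_ifs <;> linarith
        · rw [if_pos h]; split_ifs <;> linarith
        · have h2 := Finset.single_le_sum (fun j _ => hnn j) (Finset.mem_univ j)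
          have h3 : (1 : ℝ) ≤
              (if i.val + 1 = k j then 1 else 0) + (if i.val + 2 = k j then 1 else 0) := by
            rcases h with h | h <;> rw [if_pos h] <;> split_ifs <;> norm_num
          have h4 : (0 : ℝ) ≤ (if i.val + 0 = 0 then 1 else 0) + (if i.val + 1 = n then 1 else 0) := by
            split_ifs <;> norm_num
          linarith
      have h2 : w i * w i ≤ (2 * (1 + R) ^ 2) ^ 2 := by
        rw [← sq, ← sq_abs]
        exact pow_le_pow_left₀ (abs_nonneg _) (hbound i) 2
      nlinarith [sq_nonneg (2 * (1 + R) ^ 2)]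
    · push Not at hex
      obtain ⟨h0, hn, hk⟩ := hex
      have hz : w i = 0 := by
        rw [hwi, if_pos (by have := i.2; omega), hr (i.val + 1) fun j => (hk j).1,
          hr (i.val + 2) fun j => (hk j).2]
        linear_combination -ρ * hv i.val (by omega)
      rw [hz, mul_zero]
      refine mul_nonneg (sq_nonneg _) (add_nonneg ?_ hsum)
      split_ifs <;> norm_num
  refine (Finset.sum_le_sum fun i _ => hterm i).trans ?_
  rw [← Finset.mul_sum, Finset.sum_add_distrib, Finset.sum_add_distrib, Finset.sum_comm]
  refine mul_le_mul_of_nonneg_left ?_ (sq_nonneg _)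
  have h1 : ∑ j : Fin m, ∑ i : Fin n, ((if i.val + 1 = k j then (1 : ℝ) else 0) +
      (if i.val + 2 = k j then 1 else 0)) ≤ ∑ j : Fin m, 2 := by
    refine Finset.sum_le_sum fun j _ => ?_
    rw [Finset.sum_add_distrib]
    linarith [sum_ite_val_add_eq_le n 1 (k j), sum_ite_val_add_eq_le n 2 (k j)]
  rw [Finset.sum_const, Finset.card_univ, Fintype.card_fin, nsmul_eq_mul] at h1
  linarith [sum_ite_val_add_eq_le n 0 0, sum_ite_val_add_eq_le n 1 n]

/-- The squared modulus of the Fourier transform of a vector. -/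
noncomputable def fourierWeight {n : ℕ} (u : Fin n → ℝ) (θ : ℝ) : ℝ :=
  (u ⬝ᵥ fun j => Real.cos (θ * (j.val + 1))) ^ 2 + (u ⬝ᵥ fun j => Real.sin (θ * (j.val + 1))) ^ 2

theorem continuous_fourierWeight {n : ℕ} (u : Fin n → ℝ) : Continuous (fourierWeight u) := by
  unfold fourierWeight dotProduct
  fun_prop

theorem fourierWeight_nonneg {n : ℕ} (u : Fin n → ℝ) (θ : ℝ) : 0 ≤ fourierWeight u θ := by
  unfold fourierWeight; positivity

theorem integral_cos_mul_sub (s t : ℕ) :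
    ∫ θ in (0 : ℝ)..2 * Real.pi, Real.cos (θ * ((s : ℝ) - t)) =
      if s = t then 2 * Real.pi else 0 := by
  split_ifs with h
  · simp [h]
  · have hst : (s : ℝ) - t ≠ 0 := sub_ne_zero.2 (by exact_mod_cast h)
    rw [intervalIntegral.integral_comp_mul_right _ hst, integral_cos]
    have : 2 * Real.pi * ((s : ℝ) - t) = ((2 * ((s : ℤ) - t) : ℤ) : ℝ) * Real.pi := by
      push_cast; ring
    rw [this, Real.sin_int_mul_pi]
    simp

/-- Parseval: the weight is `∑ u_s u_t cos (θ (s - t))`, and only the diagonal survives integration.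
-/
theorem integral_fourierWeight {n : ℕ} (u : Fin n → ℝ) :
    ∫ θ in (0 : ℝ)..2 * Real.pi, fourierWeight u θ = 2 * Real.pi * (u ⬝ᵥ u) := by
  have h : ∀ θ, fourierWeight u θ =
      ∑ s, ∑ t, u s * u t * Real.cos (θ * ((s.val : ℝ) - (t.val : ℕ))) := by
    intro θ
    simp only [fourierWeight, dotProduct, sq, Finset.sum_mul_sum, ← Finset.sum_add_distrib]
    refine Finset.sum_congr rfl fun s _ => Finset.sum_congr rfl fun t _ => ?_
    have : θ * ((s.val : ℝ) - (t.val : ℕ)) = θ * (s.val + 1) - θ * (t.val + 1) := by ring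
    rw [this, Real.cos_sub]; ring
  simp only [h]
  rw [intervalIntegral.integral_finsetSum fun s _ =>
    Continuous.intervalIntegrable (by fun_prop) _ _]
  simp only [dotProduct, Finset.mul_sum]
  refine Finset.sum_congr rfl fun s _ => ?_
  rw [intervalIntegral.integral_finsetSum fun t _ =>
    Continuous.intervalIntegrable (by fun_prop) _ _]
  simp only [intervalIntegral.integral_const_mul, integral_cos_mul_sub]
  rw [Finset.sum_eq_single s]
  · simp; ring
  · intro t _ ht
    rw [if_neg fun h => ht (by ext; exact h.symm), mul_zero]
  · simp

/-- Uniform continuity near the diagonal and boundedness of `f` away from it, as in Chebyshev's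
inequality. Only `t` is confined to `S`: it will be a value of the symbol, while `s` will be an
eigenvalue, possibly an outlier. -/
theorem exists_quadratic_bound (f : BoundedContinuousFunction ℝ ℝ) {S : Set ℝ} (hS : IsCompact S)
    {e : ℝ} (he : 0 < e) : ∃ M, 0 ≤ M ∧ ∀ t ∈ S, ∀ s, |f s - f t| ≤ e + M * (s - t) ^ 2 := by
  have h := hS.uniformContinuousAt_of_continuousAt f (fun a _ => f.continuous.continuousAt)
    (Metric.dist_mem_uniformity he)
  obtain ⟨d, hd, hd'⟩ := Metric.mem_uniformity_dist.1 h
  refine ⟨2 * ‖f‖ / d ^ 2, by positivity, fun t ht s => ?_⟩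
  by_cases hst : |s - t| < d
  · have := hd' (a := t) (b := s) (by rwa [dist_comm, Real.dist_eq]) ht
    replace this : |f t - f s| < e := this
    rw [abs_sub_comm] at this
    have h2 : 0 ≤ 2 * ‖f‖ / d ^ 2 * (s - t) ^ 2 := by positivity
    linarith
  · have h1 : |f s - f t| ≤ 2 * ‖f‖ := by
      rw [← Real.dist_eq]; exact f.dist_le_two_norm s t
    have h2 : d ^ 2 ≤ (s - t) ^ 2 := by
      rw [← sq_abs (s - t)]; exact pow_le_pow_left₀ hd.le (not_lt.1 hst) 2
    have h3 : 2 * ‖f‖ ≤ 2 * ‖f‖ / d ^ 2 * (s - t) ^ 2 := by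
      rw [div_mul_eq_mul_div, le_div_iff₀ (by positivity)]
      exact mul_le_mul_of_nonneg_left h2 (by positivity)
    linarith

theorem integral_esd {n : ℕ} {A : Matrix (Fin n) (Fin n) ℝ} {l : Fin n → ℝ}
    (h : eigs A = Finset.univ.val.map l) (f : BoundedContinuousFunction ℝ ℝ) :
    ∫ x, f x ∂(esd A) = (n : ℝ)⁻¹ * ∑ i, f (l i) := by
  have h1 : ((eigs A).map fun x => Measure.dirac x).sum =
      ∑ i : Fin n, Measure.dirac (l i) := by
    rw [h, Multiset.map_map]; rfl
  rw [esd, h1, integral_smul_measure, integral_finsetSum_measure]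
  · simp
  · intro i _; exact f.integrable _

/-- For each `θ` the Fourier weights of the eigenvectors form a measure on the spectrum of mass `n`
whose second moment about the symbol value `g θ` is at most `2 K`. So it is concentrated at `g θ`;
integrating over `θ` gives each eigenvalue mass `2π`. -/
theorem hasASD_of_coeff {m : ℕ} {ρ R : ℝ} (hρ : |ρ| ≤ R) (r : ℕ → ℕ → ℝ) (k : ℕ → Fin m → ℕ)
    (hr : ∀ n t, (∀ j, t ≠ k n j) → r n t = ρ) (hR : ∀ n t, |r n t| ≤ R) :
    HasASD (fun n => (arMatrix (r n) n)ᵀ * arMatrix (r n) n) (limitLaw ρ) := by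
  refine ⟨inferInstance, fun f => ?_⟩
  set K : ℝ := (2 * (1 + R) ^ 2) ^ 2 * (2 + 2 * m) with hK
  have hK0 : 0 ≤ K := by positivity
  have main : ∀ e M : ℝ, 0 ≤ M → (∀ t ∈ Set.Icc ((1 - |ρ|) ^ 2) ((1 + |ρ|) ^ 2),
      ∀ s, |f s - f t| ≤ e + M * (s - t) ^ 2) → ∀ n : ℕ, 0 < n →
      |∫ x, f x ∂(esd ((arMatrix (r n) n)ᵀ * arMatrix (r n) n)) - ∫ x, f x ∂(limitLaw ρ)| ≤
        e + M * (2 * K) / n := by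
    intro e M hM hf n hn
    have hn' : (0 : ℝ) < n := by exact_mod_cast hn
    obtain ⟨u, l, he, hpar, hl, hu⟩ :=
      exists_eigenbasis (isHermitian_transpose_mul_arMatrix (r n) n)
    set A := (arMatrix (r n) n)ᵀ * arMatrix (r n) n with hA
    set g : ℝ → ℝ := fun θ => 1 + ρ ^ 2 - 2 * ρ * Real.cos θ with hg
    have hgc : Continuous g := by rw [hg]; fun_prop
    have hsum : ∀ θ, ∑ i, fourierWeight (u i) θ = n := by
      intro θ
      simp only [fourierWeight, Finset.sum_add_distrib, hpar]
      simp only [dotProduct, ← Finset.sum_add_distrib, ← sq, Real.cos_sq_add_sin_sq]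
      simp
    have hres : ∀ θ, ∑ i, fourierWeight (u i) θ * (l i - g θ) ^ 2 ≤ 2 * K := by
      intro θ
      have haux : ∀ q : Fin n → ℝ, ∑ i, (u i ⬝ᵥ q) ^ 2 * (l i - g θ) ^ 2 =
          (A *ᵥ q - g θ • q) ⬝ᵥ (A *ᵥ q - g θ • q) := by
        intro q
        rw [← hpar]
        refine Finset.sum_congr rfl fun i _ => ?_
        rw [dotProduct_sub, hl, dotProduct_smul, smul_eq_mul]; ring
      have hwave : ∀ φ : ℝ → ℝ, (∀ x, |φ x| ≤ 1) →
          (∀ x, φ (x + θ) + φ (x - θ) = 2 * Real.cos θ * φ x) →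
          ∑ i, (u i ⬝ᵥ fun j : Fin n => φ (θ * (j.val + 1))) ^ 2 * (l i - g θ) ^ 2 ≤ K := by
        intro φ hφ1 hφ
        rw [haux]
        -- The wave is set to `0` at time `0` to respect `y_0 = 0`; the cosine itself would give
        -- `1`.
        refine residual_plane_wave_le hρ (r n) (k n) (hr n) (hR n) n (c := Real.cos θ)
          (Real.abs_cos_le_one θ) (fun t => if t = 0 then 0 else φ (θ * t)) (by simp) ?_ ?_ _ ?_
        · intro t
          by_cases ht : t = 0
          · simp [ht]
          · simpa [ht] using hφ1 _
        · intro t ht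
          have h1 := hφ (θ * ((t : ℝ) + 1))
          rw [show θ * ((t : ℝ) + 1) + θ = θ * ((t : ℝ) + 2) by ring,
            show θ * ((t : ℝ) + 1) - θ = θ * t by ring] at h1
          simpa [show t ≠ 0 by omega] using h1
        · simp [hA, hg]
      simp only [fourierWeight, add_mul, Finset.sum_add_distrib]
      have h1 := hwave Real.cos Real.abs_cos_le_one fun x => by
        rw [Real.cos_add, Real.cos_sub]; ring
      have h2 := hwave Real.sin Real.abs_sin_le_one fun x => by
        rw [Real.sin_add, Real.sin_sub]; ring
      linarith
    have hpt : ∀ θ, |∑ i, fourierWeight (u i) θ * (f (l i) - f (g θ))| ≤ e * n + M * (2 * K) := by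
      intro θ
      refine (Finset.abs_sum_le_sum_abs _ _).trans ?_
      have h1 : ∀ i, |fourierWeight (u i) θ * (f (l i) - f (g θ))| ≤
          e * fourierWeight (u i) θ + M * (fourierWeight (u i) θ * (l i - g θ) ^ 2) := by
        intro i
        rw [abs_mul, abs_of_nonneg (fourierWeight_nonneg _ _)]
        have := mul_le_mul_of_nonneg_left (hf _ (mem_Icc_symbol ρ θ) (l i))
          (fourierWeight_nonneg (u i) θ)
        linarith
      refine (Finset.sum_le_sum fun i _ => h1 i).trans ?_
      rw [Finset.sum_add_distrib, ← Finset.mul_sum, ← Finset.mul_sum, hsum]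
      linarith [mul_le_mul_of_nonneg_left (hres θ) hM]
    have hint : ∫ θ in (0 : ℝ)..2 * Real.pi, ∑ i, fourierWeight (u i) θ * (f (l i) - f (g θ)) =
        2 * Real.pi * ∑ i, f (l i) - n * ∫ θ in (0 : ℝ)..2 * Real.pi, f (g θ) := by
      have h1 : ∀ θ, ∑ i, fourierWeight (u i) θ * (f (l i) - f (g θ)) =
          ∑ i, fourierWeight (u i) θ * f (l i) - n * f (g θ) := by
        intro θ
        simp only [mul_sub, Finset.sum_sub_distrib, ← Finset.sum_mul, hsum]
      have hc := fun i => continuous_fourierWeight (u i)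
      simp only [h1]
      rw [intervalIntegral.integral_sub, intervalIntegral.integral_const_mul,
        intervalIntegral.integral_finsetSum, Finset.mul_sum]
      · congr 1
        refine Finset.sum_congr rfl fun i _ => ?_
        rw [intervalIntegral.integral_mul_const, integral_fourierWeight, hu, mul_one]
      · exact fun i _ => ((hc i).mul continuous_const).intervalIntegrable _ _
      · exact (continuous_finsetSum _ fun i _ => (hc i).mul continuous_const).intervalIntegrable
          _ _
      · exact (continuous_const.mul (f.continuous.comp hgc)).intervalIntegrable _ _
    have hnorm := intervalIntegral.norm_integral_le_of_norm_le_const (a := 0)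
      (b := 2 * Real.pi) (fun θ (_ : θ ∈ Set.uIoc 0 (2 * Real.pi)) =>
        (Real.norm_eq_abs _).trans_le (hpt θ))
    rw [hint, Real.norm_eq_abs, sub_zero, abs_of_pos Real.two_pi_pos] at hnorm
    rw [integral_esd he, integral_limitLaw]
    have hpi := Real.two_pi_pos
    have hfac : (n : ℝ)⁻¹ * ∑ i, f (l i) -
        (2 * Real.pi)⁻¹ * ∫ θ in (0 : ℝ)..2 * Real.pi, f (1 + ρ ^ 2 - 2 * ρ * Real.cos θ) =
        (2 * Real.pi * ∑ i, f (l i) - n * ∫ θ in (0 : ℝ)..2 * Real.pi, f (g θ)) /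
          (2 * Real.pi * n) := by
      rw [hg]; field_simp
    rw [hfac, abs_div, abs_of_pos (mul_pos hpi hn'), div_le_iff₀ (mul_pos hpi hn')]
    refine hnorm.trans (le_of_eq ?_)
    field_simp
  rw [Metric.tendsto_atTop]
  intro e he
  obtain ⟨M, hM, hf⟩ := exists_quadratic_bound f
    (isCompact_Icc (a := (1 - |ρ|) ^ 2) (b := (1 + |ρ|) ^ 2)) (half_pos he)
  have hlim : Tendsto (fun n : ℕ => M * (2 * K) / (n : ℝ)) atTop (𝓝 0) :=
    tendsto_const_div_atTop_nhds_zero_nat _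
  obtain ⟨N, hN⟩ := eventually_atTop.1
    ((hlim.eventually (gt_mem_nhds (half_pos he))).and (eventually_gt_atTop 0))
  refine ⟨N, fun n hn => ?_⟩
  obtain ⟨h1, h2⟩ := hN n hn
  rw [Real.dist_eq]
  linarith [main _ M hM hf n h2]

end SpectralDistribution

/-! ### The quadratic equation and the location of its roots -/

section Roots

theorem root_spec {ρ ε x : ℝ} (hε : |ρ| < |ρ + ε|)
    (hx : (2 * (ε + ρ) ^ 2 * x - ρ * ε * (ε + 2 * ρ)) ^ 2 =
      ρ ^ 2 * ε ^ 2 * (ε + 2 * ρ) ^ 2 + 4 * ρ ^ 2 * (ε + ρ) ^ 2) :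
    (ρ + ε) ^ 2 * x ^ 2 - ρ * ((ρ + ε) ^ 2 - ρ ^ 2) * x - ρ ^ 2 = 0 := by
  have hR : (ρ + ε) ^ 2 ≠ 0 := by
    have : 0 < |ρ + ε| := (abs_nonneg ρ).trans_lt hε
    exact pow_ne_zero 2 (abs_pos.1 this)
  have h : 4 * (ρ + ε) ^ 2 *
      ((ρ + ε) ^ 2 * x ^ 2 - ρ * ((ρ + ε) ^ 2 - ρ ^ 2) * x - ρ ^ 2) = 0 := by
    linear_combination hx
  exact (mul_eq_zero.1 h).resolve_left (mul_ne_zero four_ne_zero hR)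

/-- The first bound gives the two roots opposite signs, the second puts both in `(-1, 1)`. With `R =
ρ + ε` and `b = ρ ε (ε + 2ρ) = ρ (R² - ρ²)`, the second amounts to `|b| < R² - ρ²`, which is where
`|ρ| < 1` enters. -/
theorem sqrt_disc_bounds {ρ ε : ℝ} (hρ : |ρ| < 1) (hρ0 : ρ ≠ 0) (hε : |ρ| < |ρ + ε|) :
    |ρ * ε * (ε + 2 * ρ)| <
      √(ρ ^ 2 * ε ^ 2 * (ε + 2 * ρ) ^ 2 + 4 * ρ ^ 2 * (ε + ρ) ^ 2) ∧
    √(ρ ^ 2 * ε ^ 2 * (ε + 2 * ρ) ^ 2 + 4 * ρ ^ 2 * (ε + ρ) ^ 2) <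
      2 * (ε + ρ) ^ 2 - |ρ * ε * (ε + 2 * ρ)| := by
  have hsq : ρ ^ 2 < (ε + ρ) ^ 2 := by rw [add_comm ε ρ]; exact sq_lt_sq.2 hε
  have hρ2 : 0 < ρ ^ 2 := by positivity
  have hb : |ρ * ε * (ε + 2 * ρ)| = |ρ| * ((ε + ρ) ^ 2 - ρ ^ 2) := by
    rw [show ρ * ε * (ε + 2 * ρ) = ρ * ((ε + ρ) ^ 2 - ρ ^ 2) by ring, abs_mul,
      abs_of_pos (sub_pos.2 hsq)]
  have hb2 : |ρ * ε * (ε + 2 * ρ)| < (ε + ρ) ^ 2 - ρ ^ 2 := by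
    rw [hb]; nlinarith
  have hsq2 : ρ ^ 2 * ε ^ 2 * (ε + 2 * ρ) ^ 2 = |ρ * ε * (ε + 2 * ρ)| ^ 2 := by
    rw [sq_abs]; ring
  set b := |ρ * ε * (ε + 2 * ρ)| with hbdef
  rw [hsq2]
  constructor
  · refine Real.lt_sqrt_of_sq_lt ?_
    have : 0 < ρ ^ 2 * (ε + ρ) ^ 2 := mul_pos hρ2 (hρ2.trans hsq)
    linarith
  · rw [Real.sqrt_lt' (by nlinarith)]
    nlinarith [mul_pos (hρ2.trans hsq) (sub_pos.2 hb2)]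

theorem tRoot_spec {ρ ε : ℝ} (hρ : |ρ| < 1) (hρ0 : ρ ≠ 0) (hε : |ρ| < |ρ + ε|) :
    (ρ + ε) ^ 2 * tRoot ρ ε ^ 2 - ρ * ((ρ + ε) ^ 2 - ρ ^ 2) * tRoot ρ ε - ρ ^ 2 = 0 ∧
      0 < tRoot ρ ε ∧ tRoot ρ ε < 1 := by
  obtain ⟨h1, h2⟩ := sqrt_disc_bounds hρ hρ0 hε
  have hR : 0 < 2 * (ε + ρ) ^ 2 := by
    linarith [(abs_nonneg (ρ * ε * (ε + 2 * ρ))).trans_lt h1, abs_nonneg (ρ * ε * (ε + 2 * ρ))]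
  have h3 := neg_abs_le (ρ * ε * (ε + 2 * ρ))
  have h4 := le_abs_self (ρ * ε * (ε + 2 * ρ))
  refine ⟨root_spec hε ?_, div_pos (by linarith) hR, (div_lt_one hR).2 (by linarith)⟩
  rw [tRoot, mul_div_cancel₀ _ hR.ne', add_sub_cancel_left, Real.sq_sqrt (by positivity)]

theorem sRoot_spec {ρ ε : ℝ} (hρ : |ρ| < 1) (hρ0 : ρ ≠ 0) (hε : |ρ| < |ρ + ε|) :
    (ρ + ε) ^ 2 * sRoot ρ ε ^ 2 - ρ * ((ρ + ε) ^ 2 - ρ ^ 2) * sRoot ρ ε - ρ ^ 2 = 0 ∧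
      sRoot ρ ε < 0 ∧ -1 < sRoot ρ ε := by
  obtain ⟨h1, h2⟩ := sqrt_disc_bounds hρ hρ0 hε
  have hR : 0 < 2 * (ε + ρ) ^ 2 := by
    linarith [(abs_nonneg (ρ * ε * (ε + 2 * ρ))).trans_lt h1, abs_nonneg (ρ * ε * (ε + 2 * ρ))]
  have h3 := neg_abs_le (ρ * ε * (ε + 2 * ρ))
  have h4 := le_abs_self (ρ * ε * (ε + 2 * ρ))
  refine ⟨root_spec hε ?_, div_neg_of_neg_of_pos (by linarith) hR,
    (lt_div_iff₀ hR).2 (by linarith)⟩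
  rw [sRoot, mul_div_cancel₀ _ hR.ne', sub_sub_cancel_left, neg_sq,
    Real.sq_sqrt (by positivity)]

/-- Removes the case distinction on the sign of `ρ`: only the sign of `ρ x` matters from here on. -/
theorem exists_root_left {ρ ε : ℝ} (hρ : |ρ| < 1) (hρ0 : ρ ≠ 0) (hε : |ρ| < |ρ + ε|) :
    ∃ x, (ρ + ε) ^ 2 * x ^ 2 - ρ * ((ρ + ε) ^ 2 - ρ ^ 2) * x - ρ ^ 2 = 0 ∧ x ≠ 0 ∧ |x| < 1 ∧
      0 < ρ * x ∧ leftFormula ρ ε = joukowski ρ x := by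
  obtain ⟨t1, t2, t3⟩ := tRoot_spec hρ hρ0 hε
  obtain ⟨s1, s2, s3⟩ := sRoot_spec hρ hρ0 hε
  rcases lt_or_gt_of_ne hρ0 with h | h
  · exact ⟨_, s1, s2.ne, abs_lt.2 ⟨s3, by linarith⟩, mul_pos_of_neg_of_neg h s2,
      by rw [leftFormula, if_pos h]⟩
  · exact ⟨_, t1, t2.ne', abs_lt.2 ⟨by linarith, t3⟩, mul_pos h t2,
      by rw [leftFormula, if_neg h.not_gt]⟩

theorem exists_root_right {ρ ε : ℝ} (hρ : |ρ| < 1) (hρ0 : ρ ≠ 0) (hε : |ρ| < |ρ + ε|) :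
    ∃ x, (ρ + ε) ^ 2 * x ^ 2 - ρ * ((ρ + ε) ^ 2 - ρ ^ 2) * x - ρ ^ 2 = 0 ∧ x ≠ 0 ∧ |x| < 1 ∧
      ρ * x < 0 ∧ rightFormula ρ ε = joukowski ρ x := by
  obtain ⟨t1, t2, t3⟩ := tRoot_spec hρ hρ0 hε
  obtain ⟨s1, s2, s3⟩ := sRoot_spec hρ hρ0 hε
  rcases lt_or_gt_of_ne hρ0 with h | h
  · exact ⟨_, t1, t2.ne', abs_lt.2 ⟨by linarith, t3⟩, mul_neg_of_neg_of_pos h t2,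
      by rw [rightFormula, if_pos h]⟩
  · exact ⟨_, s1, s2.ne, abs_lt.2 ⟨s3, by linarith⟩, mul_neg_of_pos_of_neg h s2,
      by rw [rightFormula, if_neg h.not_gt]⟩

theorem two_mul_abs_lt {ρ x : ℝ} (hρ0 : ρ ≠ 0) (hx0 : x ≠ 0) (hx : |x| < 1) :
    2 * |ρ| < |ρ * x| + |ρ * x⁻¹| := by
  rw [abs_mul, abs_mul, abs_inv, ← mul_add, mul_comm]
  refine mul_lt_mul_of_pos_left ?_ (abs_pos.2 hρ0)
  have hx' := abs_pos.2 hx0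
  rw [← sub_pos]
  have : |x| + |x|⁻¹ - 2 = (1 - |x|) ^ 2 / |x| := by field_simp; ring
  rw [this]
  have := sub_pos.2 hx
  positivity

/-- `ρ x` and `ρ x⁻¹` have the same sign, and their absolute values add up to more than `2 |ρ|` by
the strict inequality `|x| + |x|⁻¹ > 2`. -/
theorem joukowski_lt {ρ x : ℝ} (hx : |x| < 1) (h : 0 < ρ * x) :
    joukowski ρ x < (1 - |ρ|) ^ 2 := by
  have hρ0 : ρ ≠ 0 := fun h0 => by simp [h0] at h
  have hx0 : x ≠ 0 := fun h0 => by simp [h0] at h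
  have h2 : 0 < ρ * x⁻¹ := by
    have : ρ * x⁻¹ = ρ * x * x⁻¹ ^ 2 := by field_simp
    rw [this]; positivity
  have := two_mul_abs_lt hρ0 hx0 hx
  rw [abs_of_pos h, abs_of_pos h2] at this
  rw [joukowski, sub_sq, sq_abs]
  linarith

theorem lt_joukowski {ρ x : ℝ} (hx : |x| < 1) (h : ρ * x < 0) :
    (1 + |ρ|) ^ 2 < joukowski ρ x := by
  have hρ0 : ρ ≠ 0 := fun h0 => by simp [h0] at h
  have hx0 : x ≠ 0 := fun h0 => by simp [h0] at h
  have h2 : ρ * x⁻¹ < 0 := by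
    have : ρ * x⁻¹ = ρ * x * x⁻¹ ^ 2 := by field_simp
    rw [this]; exact mul_neg_of_neg_of_pos h (by positivity)
  have := two_mul_abs_lt hρ0 hx0 hx
  rw [abs_of_neg h, abs_of_neg h2] at this
  rw [joukowski, add_sq, sq_abs]
  linarith

end Roots

/-! ### Modes localized at the breaks and the lower count -/

section LocalizedModes

/-- The eigenmode localized at a change from `ρ` to `R` at time `k`, truncated at distance `L`. -/
noncomputable def localizedMode (ρ R x : ℝ) (k L t : ℕ) : ℝ :=
  if t < k then (if k ≤ t + L then ρ * x ^ (k - 1 - t) else 0)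
  else if t < k + L then R * x ^ (t - k + 1) else 0

variable {ρ R x : ℝ} {k L : ℕ}

theorem localizedMode_left {t a : ℕ} (h : k = t + 1 + a) (ha : a < L) :
    localizedMode ρ R x k L t = ρ * x ^ a := by
  rw [localizedMode, if_pos (by omega), if_pos (by omega)]
  congr 2; omega

theorem localizedMode_right {t a : ℕ} (h : t = k + a) (ha : a < L) :
    localizedMode ρ R x k L t = R * x ^ (a + 1) := by
  rw [localizedMode, if_neg (by omega), if_pos (by omega)]
  congr 2; omega

theorem localizedMode_eq_zero {t : ℕ} (h : t + L < k ∨ k + L ≤ t) :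
    localizedMode ρ R x k L t = 0 := by
  rw [localizedMode]
  rcases h with h | h
  · rw [if_pos (by omega), if_neg (by omega)]
  · rw [if_neg (by omega), if_neg (by omega)]

/-- Away from `k` a geometric sequence of ratio `x` or `x⁻¹` solves the constant-coefficient
recurrence. The amplitudes `ρ` and `R` settle the equation at time `k` for every `x`, and the
equation at time `k - 1` is the quadratic `heq`. What remains are the cuts, which spoil two times at
each end: `k - L - 1`, `k - L`, `k + L - 1` and `k + L`. -/
theorem localizedMode_residual (hx0 : x ≠ 0) (hx1 : |x| < 1)
    (heq : R ^ 2 * x ^ 2 - ρ * (R ^ 2 - ρ ^ 2) * x - ρ ^ 2 = 0) (hL : 2 ≤ L) (r : ℕ → ℝ)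
    (hrk : r k = R) (hr : ∀ t, t ≠ k → k ≤ t + L → t ≤ k + L → r t = ρ) (i : ℕ) :
    |(localizedMode ρ R x k L (i + 1) - r (i + 1) * localizedMode ρ R x k L i) -
        r (i + 2) * (localizedMode ρ R x k L (i + 2) -
          r (i + 2) * localizedMode ρ R x k L (i + 1)) -
        joukowski ρ x * localizedMode ρ R x k L (i + 1)| ≤
      ((ρ ^ 2 + |ρ * R|) * |x| ^ (L - 1)) *
        ((if i + (L + 2) = k then 1 else 0) + (if i + (L + 1) = k then 1 else 0) +
         (if i + 2 = k + L then 1 else 0) + (if i + 1 = k + L then 1 else 0)) := by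
  have hxx : x * x⁻¹ = 1 := mul_inv_cancel₀ hx0
  have hz : ∀ y : ℝ, y = 0 → |y| ≤ ((ρ ^ 2 + |ρ * R|) * |x| ^ (L - 1)) *
        ((if i + (L + 2) = k then 1 else 0) + (if i + (L + 1) = k then 1 else 0) +
         (if i + 2 = k + L then 1 else 0) + (if i + 1 = k + L then 1 else 0)) := by
    intro y hy
    rw [hy, abs_zero]
    refine mul_nonneg (by positivity) ?_
    split_ifs <;> norm_num
  have hbig : ∀ y c : ℝ, ∀ a, |c| ≤ ρ ^ 2 + |ρ * R| → L - 1 ≤ a → y = c * x ^ a →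
      (i + (L + 2) = k ∨ i + (L + 1) = k ∨ i + 2 = k + L ∨ i + 1 = k + L) →
      |y| ≤ ((ρ ^ 2 + |ρ * R|) * |x| ^ (L - 1)) *
        ((if i + (L + 2) = k then 1 else 0) + (if i + (L + 1) = k then 1 else 0) +
         (if i + 2 = k + L then 1 else 0) + (if i + 1 = k + L then 1 else 0)) := by
    intro y c a hc ha hy hex
    have h1 : |y| ≤ (ρ ^ 2 + |ρ * R|) * |x| ^ (L - 1) := by
      rw [hy, abs_mul, abs_pow]
      exact mul_le_mul hc (pow_le_pow_of_le_one (abs_nonneg _) hx1.le ha) (by positivity)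
        (by positivity)
    refine h1.trans (le_mul_of_one_le_right (by positivity) ?_)
    rcases hex with h | h | h | h <;> rw [if_pos h] <;> split_ifs <;> norm_num
  have hc1 : |ρ ^ 2| ≤ ρ ^ 2 + |ρ * R| := by
    rw [abs_of_nonneg (sq_nonneg ρ)]; linarith [abs_nonneg (ρ * R)]
  have hc2 : |ρ * R| ≤ ρ ^ 2 + |ρ * R| := by linarith [sq_nonneg ρ]
  rw [joukowski]
  rcases lt_or_ge k (i + 1) with hik | hik
  · obtain ⟨a, rfl⟩ := Nat.exists_eq_add_of_le (show k ≤ i by omega)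
    rcases lt_trichotomy (a + 2) L with h | h | h
    · refine hz _ ?_
      rw [localizedMode_right (a := a) rfl (by omega),
        localizedMode_right (a := a + 1) (by omega) (by omega),
        localizedMode_right (a := a + 2) (by omega) (by omega),
        hr (k + a + 1) (by omega) (by omega) (by omega),
        hr (k + a + 2) (by omega) (by omega) (by omega)]
      linear_combination ρ * R * x ^ (a + 1) * hxx
    · refine hbig _ (ρ * R) (a + 3) hc2 (by omega) ?_ (by omega)
      rw [localizedMode_right (a := a) rfl (by omega),
        localizedMode_right (a := a + 1) (by omega) (by omega),
        localizedMode_eq_zero (t := k + a + 2) (by omega),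
        hr (k + a + 1) (by omega) (by omega) (by omega),
        hr (k + a + 2) (by omega) (by omega) (by omega)]
      linear_combination ρ * R * x ^ (a + 1) * hxx
    · rcases Nat.lt_or_ge a L with h' | h'
      · refine hbig _ (-(ρ * R)) (a + 1) (by rwa [abs_neg]) (by omega) ?_ (by omega)
        rw [localizedMode_right (a := a) rfl (by omega),
          localizedMode_eq_zero (t := k + a + 1) (by omega),
          localizedMode_eq_zero (t := k + a + 2) (by omega),
          hr (k + a + 1) (by omega) (by omega) (by omega)]
        ring
      · refine hz _ ?_
        rw [localizedMode_eq_zero (t := k + a) (by omega),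
          localizedMode_eq_zero (t := k + a + 1) (by omega),
          localizedMode_eq_zero (t := k + a + 2) (by omega)]
        ring
  · rcases Nat.lt_or_ge (i + 2) k with hik2 | hik2
    · obtain ⟨a, rfl⟩ := Nat.exists_eq_add_of_le (show i + 3 ≤ k by omega)
      rcases lt_trichotomy (a + 2) L with h | h | h
      · refine hz _ ?_
        rw [localizedMode_left (t := i) (a := a + 2) (by omega) (by omega),
          localizedMode_left (t := i + 1) (a := a + 1) (by omega) (by omega),
          localizedMode_left (t := i + 2) (a := a) (by omega) (by omega),
          hr (i + 1) (by omega) (by omega) (by omega), hr (i + 2) (by omega) (by omega) (by omega)]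
        linear_combination ρ ^ 2 * x ^ a * hxx
      · refine hbig _ (ρ ^ 2) (a + 2) hc1 (by omega) ?_ (by omega)
        rw [localizedMode_eq_zero (t := i) (by omega),
          localizedMode_left (t := i + 1) (a := a + 1) (by omega) (by omega),
          localizedMode_left (t := i + 2) (a := a) (by omega) (by omega),
          hr (i + 2) (by omega) (by omega) (by omega)]
        linear_combination ρ ^ 2 * x ^ a * hxx
      · rcases Nat.lt_or_ge a L with h' | h'
        · refine hbig _ (-ρ ^ 2) a (by rwa [abs_neg]) (by omega) ?_ (by omega)
          rw [localizedMode_eq_zero (t := i) (by omega),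
            localizedMode_eq_zero (t := i + 1) (by omega),
            localizedMode_left (t := i + 2) (a := a) (by omega) (by omega),
            hr (i + 2) (by omega) (by omega) (by omega)]
          ring
        · refine hz _ ?_
          rw [localizedMode_eq_zero (t := i) (by omega),
            localizedMode_eq_zero (t := i + 1) (by omega),
            localizedMode_eq_zero (t := i + 2) (by omega)]
          ring
    · refine hz _ ?_
      rcases Nat.lt_or_ge (i + 1) k with h | h
      · obtain rfl : k = i + 2 := by omega
        rw [localizedMode_left (t := i) (a := 1) (by omega) (by omega),
          localizedMode_left (t := i + 1) (a := 0) (by omega) (by omega),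
          localizedMode_right (t := i + 2) (a := 0) (by omega) (by omega),
          hr (i + 1) (by omega) (by omega) (by omega), hrk]
        -- The equation at time `k - 1`, multiplied by `x`, is the quadratic.
        have : x * (ρ * (R ^ 2 - ρ ^ 2) + ρ ^ 2 * x⁻¹ - R ^ 2 * x) = 0 := by
          linear_combination ρ ^ 2 * hxx - heq
        linear_combination (mul_eq_zero.1 this).resolve_left hx0
      · obtain rfl : k = i + 1 := by omega
        rw [localizedMode_left (t := i) (a := 0) (by omega) (by omega),
          localizedMode_right (t := i + 1) (a := 0) (by omega) (by omega),
          localizedMode_right (t := i + 2) (a := 1) (by omega) (by omega),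
          hr (i + 2) (by omega) (by omega) (by omega), hrk]
        linear_combination ρ * R * hxx

theorem sum_sq_four_le {n : ℕ} (a b c d : ℕ) (D : ℝ) (k L : ℕ) (g : Fin n → ℝ)
    (hg : ∀ i, |g i| ≤ D * ((if i.val + a = k then 1 else 0) + (if i.val + b = k then 1 else 0) +
      (if i.val + c = L then 1 else 0) + (if i.val + d = L then 1 else 0))) :
    g ⬝ᵥ g ≤ 16 * D ^ 2 := by
  have h : ∀ i, g i * g i ≤ 4 * D ^ 2 * ((if i.val + a = k then 1 else 0) +
      (if i.val + b = k then 1 else 0) + (if i.val + c = L then 1 else 0) +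
      (if i.val + d = L then 1 else 0)) := by
    intro i
    rw [← sq, ← sq_abs]
    refine (pow_le_pow_left₀ (abs_nonneg _) (hg i) 2).trans ?_
    split_ifs <;> nlinarith [sq_nonneg D]
  refine (Finset.sum_le_sum fun i _ => h i).trans ?_
  rw [← Finset.mul_sum]
  simp only [Finset.sum_add_distrib]
  nlinarith [sum_ite_val_add_eq_le n a k, sum_ite_val_add_eq_le n b k,
    sum_ite_val_add_eq_le n c L, sum_ite_val_add_eq_le n d L, sq_nonneg D]

theorem eventually_card_le_countP {m : ℕ} (hρ0 : ρ ≠ 0) (ε x : Fin m → ℝ)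
    (hx0 : ∀ j, x j ≠ 0) (hx1 : ∀ j, |x j| < 1)
    (heq : ∀ j, (ρ + ε j) ^ 2 * x j ^ 2 - ρ * ((ρ + ε j) ^ 2 - ρ ^ 2) * x j - ρ ^ 2 = 0)
    (k : ℕ → Fin m → ℕ) (hk : ∀ L, ∀ᶠ n in atTop, (∀ j, L < k n j ∧ k n j + L < n) ∧
      ∀ i j, i ≠ j → k n i + L < k n j ∨ k n j + L < k n i)
    (r : ℕ → ℕ → ℝ) (hr : ∀ n t, (∀ j, t ≠ k n j) → r n t = ρ)
    (hrk : ∀ n, (∀ i j, i ≠ j → k n i ≠ k n j) → ∀ j, r n (k n j) = ρ + ε j)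
    (v δ : ℝ) (hδ : 0 < δ) (p : ℝ → Prop) [DecidablePred p] (hp : ∀ y, p y ↔ |y - v| < δ) :
    ∀ᶠ n in atTop, Fintype.card {j // joukowski ρ (x j) = v} ≤
      (eigs ((arMatrix (r n) n)ᵀ * arMatrix (r n) n)).countP p := by
  -- The truncation length depends on `δ` only, not on `n`. The left side bounds the squared
  -- residual, and `ρ ^ 2` is a lower bound for the squared norm of each mode.
  obtain ⟨L, hL, hLj⟩ : ∃ L, 2 ≤ L ∧ ∀ j,
      16 * ((ρ ^ 2 + |ρ * (ρ + ε j)|) * |x j| ^ (L - 1)) ^ 2 < δ ^ 2 * ρ ^ 2 := by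
    have hpos : 0 < δ ^ 2 * ρ ^ 2 := by positivity
    have h : ∀ j, ∀ᶠ L in atTop,
        16 * ((ρ ^ 2 + |ρ * (ρ + ε j)|) * |x j| ^ (L - 1)) ^ 2 < δ ^ 2 * ρ ^ 2 := by
      intro j
      have h1 : Tendsto (fun L : ℕ => |x j| ^ (L - 1)) atTop (𝓝 0) :=
        (tendsto_pow_atTop_nhds_zero_of_lt_one (abs_nonneg _) (hx1 j)).comp (tendsto_sub_atTop_nat 1)
      have h2 := ((h1.const_mul (ρ ^ 2 + |ρ * (ρ + ε j)|)).pow 2).const_mul 16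
      exact h2.eventually (gt_mem_nhds (by simpa using hpos))
    obtain ⟨L, h1, h2⟩ := ((eventually_ge_atTop 2).and (eventually_all.2 h)).exists
    exact ⟨L, h1, h2⟩
  -- Residuals live on times `k - L - 1` to `k + L`, so this spacing makes modes and residuals of
  -- different breaks disjoint and keeps them away from times `0` and `n`.
  filter_upwards [hk (2 * L + 2)] with n hn
  obtain ⟨hkn, hsep⟩ := hn
  have hrk' := hrk n fun i j hij => by have := hsep i j hij; omega
  have hloc : ∀ j t, t ≠ k n j → k n j ≤ t + L → t ≤ k n j + L → r n t = ρ := by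
    intro j t h1 h2 h3
    refine hr n t fun i => ?_
    by_cases hij : i = j
    · rwa [hij]
    · have := hsep i j hij; omega
  set w : Fin m → ℕ → ℝ := fun j => localizedMode ρ (ρ + ε j) (x j) (k n j) L with hw
  set A := (arMatrix (r n) n)ᵀ * arMatrix (r n) n with hA
  have hw0 : ∀ j, w j 0 = 0 := fun j =>
    localizedMode_eq_zero (by have := (hkn j).1; omega)
  set g : Fin m → Fin n → ℝ := fun j => A *ᵥ (fun i : Fin n => w j (i.val + 1)) -
    joukowski ρ (x j) • fun i : Fin n => w j (i.val + 1) with hg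
  have hgi : ∀ j i, |g j i| ≤ ((ρ ^ 2 + |ρ * (ρ + ε j)|) * |x j| ^ (L - 1)) *
      ((if i.val + (L + 2) = k n j then 1 else 0) + (if i.val + (L + 1) = k n j then 1 else 0) +
        (if i.val + 2 = k n j + L then 1 else 0) +
        (if i.val + 1 = k n j + L then 1 else 0)) := fun j i => by
    have h1 := localizedMode_residual (hx0 j) (hx1 j) (heq j) hL (r n) (hrk' j) (hloc j) i.val
    have h2 : g j i = (w j (i.val + 1) - r n (i.val + 1) * w j i.val) -
        r n (i.val + 2) * (w j (i.val + 2) - r n (i.val + 2) * w j (i.val + 1)) -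
        joukowski ρ (x j) * w j (i.val + 1) := by
      rw [hg]
      simp only [Pi.sub_apply, Pi.smul_apply, smul_eq_mul]
      rw [transpose_mul_arMatrix_mulVec (r n) n (w j) (hw0 j)]
      split_ifs with hi
      · rfl
      · have := (hkn j).2
        have h3 : w j (i.val + 2) = 0 := localizedMode_eq_zero (by omega)
        have h4 : w j (i.val + 1) = 0 := localizedMode_eq_zero (by omega)
        rw [h3, h4]; ring
    rw [h2]; exact h1
  refine card_le_countP_eigs (isHermitian_transpose_mul_arMatrix (r n) n) v δ
    (fun j i => w j.1 (i.val + 1)) (fun j => g j.1) ?_ ?_ ?_ ?_ p ?_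
  · intro j; rw [hg]; simp only [j.2]; rfl
  · intro i j hij
    refine Finset.sum_eq_zero fun t _ => ?_
    have hs := hsep i.1 j.1 fun h => hij (Subtype.ext h)
    by_cases h : t.val + 1 + L < k n i.1 ∨ k n i.1 + L ≤ t.val + 1
    · exact mul_eq_zero_of_left (localizedMode_eq_zero h) _
    · exact mul_eq_zero_of_right _ (localizedMode_eq_zero (by omega))
  · intro i j hij
    refine Finset.sum_eq_zero fun t _ => ?_
    have hs := hsep i.1 j.1 fun h => hij (Subtype.ext h)
    have hz : ∀ j, (t.val + 2 + L < k n j ∨ k n j + L < t.val + 1) → g j t = 0 := by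
      intro j h
      have := hgi j t
      rw [if_neg (by omega), if_neg (by omega), if_neg (by omega), if_neg (by omega)] at this
      simpa using this
    by_cases h : t.val + 2 + L < k n i.1 ∨ k n i.1 + L < t.val + 1
    · exact mul_eq_zero_of_left (hz _ h) _
    · exact mul_eq_zero_of_right _ (hz _ (by omega))
  · intro j
    refine (sum_sq_four_le _ _ _ _ _ _ _ _ (hgi j.1)).trans_lt ((hLj j.1).trans_le ?_)
    -- The entry at time `k - 1`, whose index is `k - 2`, equals `ρ`.
    refine mul_le_mul_of_nonneg_left ?_ (sq_nonneg δ)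
    obtain ⟨h1, h2⟩ := hkn j.1
    have h3 := Finset.single_le_sum
      (f := fun i : Fin n => w j.1 (i.val + 1) * w j.1 (i.val + 1))
      (fun i _ => mul_self_nonneg _) (Finset.mem_univ ⟨k n j.1 - 2, by omega⟩)
    refine le_trans (le_of_eq ?_) h3
    have h4 : w j.1 (k n j.1 - 2 + 1) = ρ * x j.1 ^ 0 :=
      localizedMode_left (by omega) (by omega)
    simp only [h4]; ring
  · intro y hy
    rw [hp, not_lt] at hy
    rw [← sq_abs (y - v)]
    exact pow_le_pow_left₀ hδ.le hy 2

end LocalizedModes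

/-! ### From eigenvalue counts to outliers with multiplicity -/

section Outliers

/-- If every point of the multiset `S` attracts at least as many eigenvalues as its multiplicity
in `S`, and the open set `I ⊇ S` contains at most `|S|` eigenvalues, then every point of `I` has
multiplicity `S.count`. -/
theorem hasMultiplicity_of_bounds {A : (n : ℕ) → Matrix (Fin n) (Fin n) ℝ} {I : Set ℝ}
    (hI : IsOpen I) {S : Multiset ℝ} (hSI : ∀ v ∈ S, v ∈ I)
    (hlow : ∀ v δ, 0 < δ → ∀ (p : ℝ → Prop) [DecidablePred p], (∀ y, p y ↔ |y - v| < δ) →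
      ∀ᶠ n in atTop, S.count v ≤ (eigs (A n)).countP p)
    (hup : ∀ n, ∀ (p : ℝ → Prop) [DecidablePred p], (∀ y, p y → y ∈ I) →
      (eigs (A n)).countP p ≤ S.card) {x : ℝ} (hx : x ∈ I) :
    HasMultiplicity A x (S.count x) := by
  classical
  -- Inserting `x` also covers the points outside `S`, for which the claim is multiplicity `0`.
  set V := insert x S.toFinset with hV
  have hVI : ∀ v ∈ V, v ∈ I := by
    intro v hv
    rcases Finset.mem_insert.1 hv with h | h
    · rwa [h]
    · exact hSI v (Multiset.mem_toFinset.1 h)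
  obtain ⟨d, hd, hdI, hdV⟩ : ∃ d > 0, (∀ v ∈ V, ∀ y, |y - v| < d → y ∈ I) ∧
      ∀ v ∈ V, ∀ v' ∈ V, v ≠ v' → 2 * d ≤ |v - v'| := by
    have h1 : ∀ v ∈ V, ∀ᶠ d in 𝓝[>] (0 : ℝ), ∀ y, |y - v| < d → y ∈ I := by
      intro v hv
      obtain ⟨d, hd, hd'⟩ := Metric.isOpen_iff.1 hI v (hVI v hv)
      filter_upwards [Ioo_mem_nhdsGT hd] with e he y hy
      exact hd' (by rw [Metric.mem_ball, Real.dist_eq]; exact hy.trans he.2)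
    have h2 : ∀ v ∈ V, ∀ v' ∈ V, ∀ᶠ d in 𝓝[>] (0 : ℝ), v ≠ v' → 2 * d ≤ |v - v'| := by
      intro v _ v' _
      by_cases hvv : v = v'
      · exact Eventually.of_forall fun d h => absurd hvv h
      · have h0 : 0 < |v - v'| / 2 := by have := abs_pos.2 (sub_ne_zero.2 hvv); positivity
        filter_upwards [Ioo_mem_nhdsGT h0] with e he _
        linarith [he.2]
    have h3 := ((V.eventually_all).2 h1).and
      ((V.eventually_all).2 fun v hv => (V.eventually_all).2 (h2 v hv))
    obtain ⟨d, ⟨h4, h5⟩, h6⟩ := (h3.and self_mem_nhdsWithin).exists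
    exact ⟨d, h6, h4, h5⟩
  refine ⟨d, hd, fun δ hδ hδd => ?_⟩
  have hev := (V.eventually_all).2 fun v (_ : v ∈ V) => hlow v δ hδ (fun y => |y - v| < δ)
    fun y => Iff.rfl
  filter_upwards [hev] with n hn
  have hSsum : S.card = ∑ v ∈ V, S.count v := by
    refine (Multiset.sum_count_eq_card ?_).symm
    intro v hv
    exact Finset.mem_insert_of_mem (Multiset.mem_toFinset.2 hv)
  have hcount : ∑ v ∈ V, (eigs (A n)).countP (fun y => |y - v| < δ) =
      (eigs (A n)).countP fun y => ∃ v ∈ V, |y - v| < δ := by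
    induction eigs (A n) using Multiset.induction_on with
    | empty => simp
    | cons a s ih =>
      simp only [Multiset.countP_cons, Finset.sum_add_distrib, ih]
      congr 1
      split_ifs with h
      · obtain ⟨v, hv, hva⟩ := h
        rw [Finset.sum_eq_single v, if_pos hva]
        · intro v' hv' hne
          refine if_neg fun h' => ?_
          have h1 := hdV v' hv' v hv hne
          have h2 := abs_sub_le v' a v
          rw [abs_sub_comm v' a] at h2
          linarith
        · exact fun h => absurd hv h
      · push Not at h
        exact Finset.sum_eq_zero fun v hv => if_neg (not_lt.2 (h v hv))
  have hle : ∑ v ∈ V, (eigs (A n)).countP (fun y => |y - v| < δ) ≤ ∑ v ∈ V, S.count v := by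
    rw [hcount, ← hSsum]
    exact hup n _ fun y ⟨v, hv, hy⟩ => hdI v hv y (hy.trans_le hδd)
  -- Each count is at least its target and the totals satisfy the reverse inequality, so equality
  -- holds termwise.
  have heq := (Finset.sum_eq_sum_iff_of_le hn).1 (le_antisymm (Finset.sum_le_sum hn) hle)
  convert (heq x (Finset.mem_insert_self x _)).symm

theorem mem_eigs_iff {n : ℕ} (A : Matrix (Fin n) (Fin n) ℝ) (y : ℝ) :
    y ∈ eigs A ↔ y ∈ spectrum ℝ A := by
  rw [eigs, Polynomial.mem_roots (Matrix.charpoly_monic A).ne_zero,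
    Matrix.mem_spectrum_iff_isRoot_charpoly]

theorem tendsto_infDist_iff {A : (n : ℕ) → Matrix (Fin n) (Fin n) ℝ}
    (hA : ∀ n, (A n).IsHermitian) {x : ℝ} {c : ℕ} (h : HasMultiplicity A x c) :
    Tendsto (fun n => Metric.infDist x (spectrum ℝ (A n))) atTop (𝓝 0) ↔ 0 < c := by
  classical
  obtain ⟨d, hd, hδ⟩ := h
  constructor
  · intro ht
    by_contra hc
    obtain rfl : c = 0 := by omega
    -- Taking `n > 0` matters: `Metric.infDist` to the empty spectrum is `0` by convention.
    obtain ⟨n, ⟨h1, h2⟩, h3⟩ := (((hδ d hd le_rfl).and (ht.eventually (gt_mem_nhds hd))).and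
      (eventually_gt_atTop 0)).exists
    have hne : (spectrum ℝ (A n)).Nonempty :=
      ⟨_, (hA n).eigenvalues_mem_spectrum_real ⟨0, h3⟩⟩
    obtain ⟨y, hy, hyx⟩ := (Metric.infDist_lt_iff hne).1 h2
    rw [Multiset.countP_eq_zero] at h1
    refine h1 y ((mem_eigs_iff _ _).2 hy) ?_
    rwa [dist_comm, Real.dist_eq] at hyx
  · intro hc
    rw [Metric.tendsto_nhds]
    intro e he
    filter_upwards [hδ (min d e) (lt_min hd he) (min_le_left _ _)] with n hn
    rw [← hn, Multiset.countP_pos] at hc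
    obtain ⟨y, hy, hyx⟩ := hc
    rw [Real.dist_eq, sub_zero, abs_of_nonneg Metric.infDist_nonneg]
    refine (Metric.infDist_le_dist_of_mem ((mem_eigs_iff _ _).1 hy)).trans_lt ?_
    rw [dist_comm, Real.dist_eq]
    exact hyx.trans_le (min_le_right _ _)

/-- Every point of `I` has a multiplicity, and it is an outlier exactly when that multiplicity is
positive; so the set and the multiplicities are found together. -/
theorem eqWithMultiplicity_of_bounds {A : (n : ℕ) → Matrix (Fin n) (Fin n) ℝ}
    (hA : ∀ n, (A n).IsHermitian) {I : Set ℝ}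
    (hI : IsOpen I) {S : Multiset ℝ} (hSI : ∀ v ∈ S, v ∈ I)
    (hlow : ∀ v δ, 0 < δ → ∀ (p : ℝ → Prop) [DecidablePred p], (∀ y, p y ↔ |y - v| < δ) →
      ∀ᶠ n in atTop, S.count v ≤ (eigs (A n)).countP p)
    (hup : ∀ n, ∀ (p : ℝ → Prop) [DecidablePred p], (∀ y, p y → y ∈ I) →
      (eigs (A n)).countP p ≤ S.card) {T : Set ℝ}
    (hT : ∀ x, x ∈ T ↔
      x ∈ I ∧ Tendsto (fun n => Metric.infDist x (spectrum ℝ (A n))) atTop (𝓝 0)) :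
    EqWithMultiplicity A T S := by
  have hmul := fun {x} (hx : x ∈ I) => hasMultiplicity_of_bounds hI hSI hlow hup hx
  refine ⟨fun x => ?_, fun x hx => hmul ((hT x).1 hx).1⟩
  rw [hT]
  constructor
  · rintro ⟨hx, h⟩
    exact Multiset.count_pos.1 ((tendsto_infDist_iff hA (hmul hx)).1 h)
  · intro hx
    exact ⟨hSI x hx, (tendsto_infDist_iff hA (hmul (hSI x hx))).2 (Multiset.count_pos.2 hx)⟩

theorem count_map_univ {m : ℕ} (F : Fin m → ℝ) (v : ℝ) :
    (Finset.univ.val.map F).count v = Fintype.card {j // F j = v} := by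
  rw [Multiset.count_map, Fintype.card_subtype]
  simp only [eq_comm (a := v)]
  rfl

theorem mem_leftOutliers_iff (A : (n : ℕ) → Matrix (Fin n) (Fin n) ℝ) {μ : Measure ℝ} {a b : ℝ}
    (hab : a ≤ b) (hμ : μ.support = Set.Icc a b) (x : ℝ) : x ∈ leftOutliers A μ ↔
      x ∈ Set.Iio a ∧ Tendsto (fun n => Metric.infDist x (spectrum ℝ (A n))) atTop (𝓝 0) := by
  rw [leftOutliers, outliers, hμ, csInf_Icc hab, isClosed_Icc.closure_eq]
  constructor
  · rintro ⟨⟨h1, _⟩, h2⟩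
    exact ⟨h2, h1⟩
  · rintro ⟨h2, h1⟩
    exact ⟨⟨h1, fun h => absurd h.1 (not_le.2 h2)⟩, h2⟩

theorem mem_rightOutliers_iff (A : (n : ℕ) → Matrix (Fin n) (Fin n) ℝ) {μ : Measure ℝ} {a b : ℝ}
    (hab : a ≤ b) (hμ : μ.support = Set.Icc a b) (x : ℝ) : x ∈ rightOutliers A μ ↔
      x ∈ Set.Ioi b ∧ Tendsto (fun n => Metric.infDist x (spectrum ℝ (A n))) atTop (𝓝 0) := by
  rw [rightOutliers, outliers, hμ, csSup_Icc hab, isClosed_Icc.closure_eq]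
  constructor
  · rintro ⟨⟨h1, _⟩, h2⟩
    exact ⟨h2, h1⟩
  · rintro ⟨h2, h1⟩
    exact ⟨⟨h1, fun h => absurd h.2 (not_le.2 h2)⟩, h2⟩

end Outliers

/-! ### Coefficients and separation of the breaks -/

section BreakPoints

theorem coeff_eq {m : ℕ} (ρ : ℝ) (ε : Fin m → ℝ) (k h : Fin m → ℕ) (hh : ∀ j, h j = 1) (t : ℕ) :
    coeff ρ ε k h t = ρ + ∑ j, if t = k j then ε j else 0 := by
  simp only [coeff, hh, Set.indicator_apply, Set.mem_Ico, mul_ite, mul_one, mul_zero]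
  congr 1
  refine Finset.sum_congr rfl fun j _ => if_congr (by omega) rfl rfl

theorem coeff_eq_of_forall_ne {m : ℕ} (ρ : ℝ) (ε : Fin m → ℝ) (k h : Fin m → ℕ)
    (hh : ∀ j, h j = 1) (t : ℕ) (ht : ∀ j, t ≠ k j) : coeff ρ ε k h t = ρ := by
  simp [coeff_eq ρ ε k h hh, ht]

theorem coeff_apply_break {m : ℕ} (ρ : ℝ) (ε : Fin m → ℝ) (k h : Fin m → ℕ)
    (hh : ∀ j, h j = 1) (hk : ∀ i j, i ≠ j → k i ≠ k j) (j : Fin m) :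
    coeff ρ ε k h (k j) = ρ + ε j := by
  rw [coeff_eq ρ ε k h hh, Finset.sum_eq_single j]
  · simp
  · exact fun i _ hi => if_neg (hk j i hi.symm)
  · simp

/-- The bound does not involve `k`, so it is uniform in `n`, and it needs no distinctness of the
breaks, which is only known for large `n`. -/
theorem abs_coeff_le {m : ℕ} (ρ : ℝ) (ε : Fin m → ℝ) (k h : Fin m → ℕ) (hh : ∀ j, h j = 1)
    (t : ℕ) : |coeff ρ ε k h t| ≤ |ρ| + ∑ j, |ε j| := by
  rw [coeff_eq ρ ε k h hh]
  refine (abs_add_le _ _).trans (add_le_add le_rfl ((Finset.abs_sum_le_sum_abs _ _).trans ?_))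
  refine Finset.sum_le_sum fun j _ => ?_
  split_ifs <;> simp

theorem breaks_separated {m : ℕ} {k h : Fin m → ℕ} (hh : ∀ j, h j = 1) {L : ℕ}
    (hgap : ∀ j, (L : ℤ) < gap k h j) :
    (∀ j, L < k j) ∧ ∀ i j, i < j → k i + L < k j := by
  have hstep : ∀ (b : ℕ) (hb : b + 1 < m), k ⟨b, by omega⟩ + L < k ⟨b + 1, hb⟩ := by
    intro b hb
    have := hgap ⟨b + 1, hb⟩
    simp only [gap, hh, Nat.succ_ne_zero, if_false, Nat.add_sub_cancel] at this
    push_cast at this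
    omega
  have hlt : ∀ (b : ℕ) (hb : b < m), L < k ⟨b, hb⟩ := by
    intro b
    induction b with
    | zero =>
      intro hb
      have := hgap ⟨0, hb⟩
      simp only [gap, if_true] at this
      omega
    | succ b ih =>
      intro hb
      have := hstep b hb
      have := ih (by omega)
      omega
  refine ⟨fun j => hlt j.1 j.2, ?_⟩
  have hlt2 : ∀ (b a : ℕ) (hb : b < m) (hab : a < b), k ⟨a, by omega⟩ + L < k ⟨b, hb⟩ := by
    intro b
    induction b with
    | zero => intro a _ h; omega
    | succ b ih =>
      intro a hb hab
      have h1 := hstep b hb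
      rcases Nat.lt_or_ge a b with h2 | h2
      · have := ih a (by omega) h2; omega
      · obtain rfl : a = b := by omega
        exact h1
  exact fun i j hij => hlt2 j.1 i.1 j.2 hij

end BreakPoints

end SCM

/-! ### The theorem -/

theorem corollary3p7 {Ω : Type*} [MeasurableSpace Ω] (P : Measure Ω) [IsProbabilityMeasure P]
    (z : ℕ → Ω → ℝ) (hz : SCM.IsUnitWhiteNoise P z)
    (ρ : ℝ) (hρ : |ρ| < 1) (hρ0 : ρ ≠ 0)
    (m : ℕ) (ε : Fin m → ℝ) (k : ℕ → Fin m → ℕ) (h : Fin m → ℕ)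
    (hh : ∀ j, h j = 1)
    (hgap : ∀ j, Tendsto (fun n : ℕ => SCM.gap (k n) h j) atTop atTop)
    (hend : ∀ j, Tendsto (fun n : ℕ => (n : ℤ) - (k n j : ℤ)) atTop atTop)
    (hε : ∀ j, |ρ| < |ρ + ε j|)
    (B : (n : ℕ) → Matrix (Fin n) (Fin n) ℝ)
    (hB : ∀ n, B n = SCM.precision P (SCM.arProcess (SCM.coeff ρ ε (k n) h) z) n) :
    SCM.HasASD B (SCM.limitLaw ρ) ∧
    (SCM.limitLaw ρ).support = Set.Icc ((1 - |ρ|) ^ 2) ((1 + |ρ|) ^ 2) ∧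
    SCM.EqWithMultiplicity B (SCM.leftOutliers B (SCM.limitLaw ρ))
      (Finset.univ.val.map fun j => SCM.leftFormula ρ (ε j)) ∧
    SCM.EqWithMultiplicity B (SCM.rightOutliers B (SCM.limitLaw ρ))
      (Finset.univ.val.map fun j => SCM.rightFormula ρ (ε j)) := by
  obtain rfl : B = fun n => (SCM.arMatrix (SCM.coeff ρ ε (k n) h) n).transpose *
      SCM.arMatrix (SCM.coeff ρ ε (k n) h) n :=
    funext fun n => (hB n).trans (SCM.precision_eq hz _ n)
  have hr := fun n => SCM.coeff_eq_of_forall_ne ρ ε (k n) h hh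
  have hk : ∀ L, ∀ᶠ n in atTop, (∀ j, L < k n j ∧ k n j + L < n) ∧
      ∀ i j, i ≠ j → k n i + L < k n j ∨ k n j + L < k n i := by
    intro L
    filter_upwards [eventually_all.2 fun j => (hgap j).eventually (eventually_gt_atTop (L : ℤ)),
      eventually_all.2 fun j => (hend j).eventually (eventually_gt_atTop (L : ℤ))] with n h1 h2
    obtain ⟨h3, h4⟩ := SCM.breaks_separated hh h1
    exact ⟨fun j => ⟨h3 j, by have := h2 j; omega⟩, fun i j hij =>
      (lt_or_gt_of_ne hij).imp (h4 i j) (h4 j i)⟩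
  have hrk := fun n => SCM.coeff_apply_break ρ ε (k n) h hh
  have hA := fun n => SCM.isHermitian_transpose_mul_arMatrix (SCM.coeff ρ ε (k n) h) n
  have hsupp := SCM.support_limitLaw hρ0
  have hab : (1 - |ρ|) ^ 2 ≤ (1 + |ρ|) ^ 2 := by nlinarith [abs_nonneg ρ]
  refine ⟨SCM.hasASD_of_coeff (R := |ρ| + ∑ j, |ε j|)
    (le_add_of_nonneg_right (Finset.sum_nonneg fun _ _ => abs_nonneg _)) _ k hr
    fun n => SCM.abs_coeff_le ρ ε (k n) h hh, hsupp, ?_, ?_⟩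
  · choose x hx1 hx2 hx3 hx4 hx5 using fun j => SCM.exists_root_left hρ hρ0 (hε j)
    refine SCM.eqWithMultiplicity_of_bounds hA (isOpen_Iio (a := (1 - |ρ|) ^ 2)) ?_ ?_ ?_
      (SCM.mem_leftOutliers_iff _ hab hsupp)
    · intro v hv
      obtain ⟨j, -, rfl⟩ := Multiset.mem_map.1 hv
      rw [hx5]
      exact SCM.joukowski_lt (hx3 j) (hx4 j)
    · intro v δ hδ p _ hp
      simp only [hx5, SCM.count_map_univ]
      exact SCM.eventually_card_le_countP hρ0 ε x hx2 hx3 hx1 k hk _ hr hrk v δ hδ p hp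
    · intro n p _ hp
      simpa using SCM.countP_eigs_lt_le ρ hρ _ (k n) (hr n) n p hp
  · choose x hx1 hx2 hx3 hx4 hx5 using fun j => SCM.exists_root_right hρ hρ0 (hε j)
    refine SCM.eqWithMultiplicity_of_bounds hA (isOpen_Ioi (a := (1 + |ρ|) ^ 2)) ?_ ?_ ?_
      (SCM.mem_rightOutliers_iff _ hab hsupp)
    · intro v hv
      obtain ⟨j, -, rfl⟩ := Multiset.mem_map.1 hv
      rw [hx5]
      exact SCM.lt_joukowski (hx3 j) (hx4 j)
    · intro v δ hδ p _ hp
      simp only [hx5, SCM.count_map_univ]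
      exact SCM.eventually_card_le_countP hρ0 ε x hx2 hx3 hx1 k hk _ hr hrk v δ hδ p hp
    · intro n p _ hp
      simpa using SCM.countP_eigs_gt_le ρ _ (k n) (hr n) n p hp
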